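/- For $f:\mathbb Z\to\mathbb R$ let $$e^{t\Delta_d}f(n)=\sum_{j\in\mathbb Z}G(t,n-j)f(j),\qquad G(t,n)=e^{-2t}I_n(2t),\qquad t>0,\ n\in\mathbb Z,$$ be the heat semigroup of the discrete Laplacian $\Delta_d f(n)=f(n+1)-2f(n)+f(n-1)$, where $I_n$ is the modified Bessel function of the first kind, $I_n(t)=\sum_{m\ge 0}\frac{1}{m!\,\Gamma(m+n+1)}(t/2)^{2m+n}$ for $n\ge 0$ and $I_{-n}=I_n$. Let $\mu=\sum_{n\in\mathbb Z}\frac1{1+|n|}\delta_n$, and for $1\le p,q\le\infty$ and $F:(0,\infty)\times\mathbb Z\to\mathbb R$ let $\|F\|_{p,q}$ be the $L^q((0,\infty),dt/t)$-norm of $t\mapsto\|F(t,\cdot)\|_{\ell^p(\mathbb Z)}$. For $\alpha>0$ let $\Lambda_H^{\alpha,p,q}$ be the set of all $f:\mathbb Z\to\mathbb R$ such that $$\frac{f}{1+|\cdot|^\alpha}\in\ell^q(\mathbb Z,\mu)\quad\text{and}\quad \big\|t^{k-\alpha/2}\,\partial_t^k e^{t\Delta_d}f\big\|_{p,q}<\infty,\qquad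 k=\lfloor\alpha/2\rfloor+1,$$ and for $0<\beta<1/2$ let $$\ell_{-\beta}=\Big\{u:\mathbb Z\to\mathbb R:\ \sum_{m\in\mathbb Z}\frac{|u(m)|}{(1+|m|)^{1-2\beta}}<\infty\Big\},\qquad (-\Delta_d)^{-\beta}f(n)=\frac1{\Gamma(\beta)}\int_0^\infty e^{\tau\Delta_d}f(n)\,\frac{d\tau}{\tau^{1-\beta}},\quad n\in\mathbb Z.$$ **Theorem.** Let $\alpha>0$, $0<\beta<1/2$, $1\le p,q\le\infty$ and $f\in\Lambda_H^{\alpha,p,q}\cap\ell_{-\beta}$. Then $(-\Delta_d)^{-\beta}f$ is well defined (the series for $e^{\tau\Delta_d}f(n)$, $\tau>0$, and the integral above converge absolutely for every $n\in\mathbb Z$), and $(-\Delta_d)^{-\beta}f\in\Lambda_H^{\alpha+2\beta,p,q}$. -/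

import Mathlib

open MeasureTheory Set
open scoped ENNReal

noncomputable section

namespace DiscreteBesov

/-- The modified Bessel function of the first kind `I_n(t)` of integer order `n`:
`I_n(t) = ∑_{m ≥ 0} (t/2)^(2m+n) / (m! Γ(m+n+1))` for `n ≥ 0`, and `I_{-n} = I_n`. -/
def besselI (n : ℤ) (t : ℝ) : ℝ :=
  ∑' m : ℕ, 1 / ((m.factorial : ℝ) * Real.Gamma ((m : ℝ) + (n.natAbs : ℝ) + 1)) *
    (t / 2) ^ (2 * m + n.natAbs)

/-- The discrete heat kernel `G(t,n) = e^{-2t} I_n(2t)`. -/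
def heatKernel (t : ℝ) (n : ℤ) : ℝ :=
  Real.exp (-2 * t) * besselI n (2 * t)

/-- The discrete heat semigroup `e^{tΔ_d} f(n) = ∑_{j ∈ ℤ} G(t,n-j) f(j)`. -/
def heatSemigroup (t : ℝ) (f : ℤ → ℝ) (n : ℤ) : ℝ :=
  ∑' j : ℤ, heatKernel t (n - j) * f j

/-- The measure `μ = ∑_{n ∈ ℤ} (1 + |n|)⁻¹ δ_n` on `ℤ`. -/
def muZ : Measure ℤ :=
  Measure.sum fun n : ℤ => ENNReal.ofReal (1 / (1 + |(n : ℝ)|)) • Measure.dirac n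

/-- The measure `dt/t` on `(0,∞)`, as a measure on `ℝ` carried by `(0,∞)`. -/
def dtOverT : Measure ℝ :=
  (volume.restrict (Ioi (0 : ℝ))).withDensity fun t => ENNReal.ofReal (1 / t)

/-- The (extended) norm of `L^q((0,∞), dt/t; ℓ^p(ℤ))`: the `L^q(dt/t)`-norm of
`t ↦ ‖F(t,·)‖_p`. For `p = ∞` or `q = ∞` it is the (essential) supremum. -/
def mixedNorm (p q : ℝ≥0∞) (F : ℝ → ℤ → ℝ) : ℝ≥0∞ :=
  eLpNorm (fun t : ℝ => eLpNorm (F t) p (Measure.count : Measure ℤ)) q dtOverT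

/-- The discrete heat Besov space `Λ_H^{α,p,q}`. The first condition is
`f / (1 + |·|^α) ∈ ℓ^q(ℤ,μ)`; the second is `‖t^{k-α/2} ∂_t^k e^{tΔ_d} f‖_{p,q} < ∞` with
`k = [α/2] + 1`. -/
def heatBesov (α : ℝ) (p q : ℝ≥0∞) : Set (ℤ → ℝ) :=
  {f | MemLp (fun n : ℤ => f n / (1 + |(n : ℝ)| ^ α)) q muZ ∧
    mixedNorm p q (fun t n => t ^ (((⌊α / 2⌋₊ + 1 : ℕ) : ℝ) - α / 2) *
      iteratedDeriv (⌊α / 2⌋₊ + 1) (fun s : ℝ => heatSemigroup s f n) t) < ∞}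

/-- The weighted space `ℓ_s` of all `u` with `∑_m |u(m)| / (1+|m|)^(1+2s) < ∞`, for real `s`
of either sign. -/
def ellSpace (s : ℝ) : Set (ℤ → ℝ) :=
  {u | Summable fun m : ℤ => |u m| / (1 + |(m : ℝ)|) ^ (1 + 2 * s)}

/-- The negative fractional power
`(-Δ_d)^{-β} f(n) = Γ(β)⁻¹ ∫_0^∞ e^{τΔ_d} f(n) dτ / τ^{1-β}`. -/
def negFracPower (β : ℝ) (f : ℤ → ℝ) (n : ℤ) : ℝ :=
  1 / Real.Gamma β * ∫ τ in Ioi (0 : ℝ), heatSemigroup τ f n / τ ^ (1 - β)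

/-- `(-Δ_d)^{-β} f` is well defined: at every point, the series that defines the heat semigroup
and the integral that defines the fractional power converge absolutely. -/
def NegFracPowerDefined (β : ℝ) (f : ℤ → ℝ) : Prop :=
  ∀ n : ℤ, (∀ τ : ℝ, 0 < τ → Summable fun j : ℤ => heatKernel τ (n - j) * f j) ∧
    IntegrableOn (fun τ : ℝ => heatSemigroup τ f n / τ ^ (1 - β)) (Ioi 0)

end DiscreteBesov

end

open MeasureTheory Set
open scoped ENNReal

noncomputable section

namespace DiscreteBesov


/-! Write `G` for the heat kernel and `⟨n⟩ = 1 + |n|`. Three facts about `G` suffice: `G(t,n) ≤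
1/⟨n⟩`, `G(t,n) ≤ 4 t^(-1/2)`, and total variation of `G(t,·)` at most `2 G(t,0)`. They follow,
without Bessel asymptotics, from mass one, the recurrence `n G(t,n) = t (G(t,n-1) - G(t,n+1))` and
monotonicity in `|n|`. Mass one and the semigroup law come from uniqueness for the heat equation
(`eq_heatSemigroup_of_hasDerivAt`).

Well-definedness: integrating the first two bounds against `τ^(β-1)` bounds the kernel of
`(-Δ)^(-β)` by `C⟨n⟩^(2β-1)`, and `f ∈ ℓ_{-β}` says exactly that this weight sums against `|f|`.
Fubini then gives `e^{tΔ}(-Δ)^(-β)f = Γ(β)⁻¹ ∫ e^{(t+τ)Δ}f τ^(β-1) dτ`.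

Seminorm condition: time derivatives are powers of `Δ`, a finite difference operator, which pass
under the integral. If `‖Δ^l e^{sΔ}f‖_p ≤ s^(-e) ψ(s)` with `e = l - α/2` and `ψ ∈ L^q(dt/t)`, then
Minkowski's inequality and `τ = tρ` bound `t^(e-β) ‖∂_t^l e^{tΔ}(-Δ)^(-β)f‖_p` by a constant times
`∫ ρ^β (1+ρ)^(-e) ψ((1+ρ)t) dρ/ρ`. This operator is bounded on `L^q(dt/t)` since `0 < β < e`, and `e
- β = l - (α+2β)/2` is the exponent required. The derivative order `l` for `α+2β` is the old `k` or
`k+1`; the extra Laplacian is paid for by `‖Δe^{tΔ}h‖_p ≤ C t⁻¹‖h‖_p`.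

Size condition: the sum bounding `(-Δ)^(-β)f(n)` is split at `⟨j⟩ = 2⟨n⟩`. The far part is at most a
constant, and `⟨n⟩^(-(α+2β)) ∈ L^q(μ)`. The near part, once normalized, is an operator that Schur's
test bounds on `L^q(μ)`. -/

/-! ### Modified Bessel functions of integer order -/

/-- The entire function `∑ x^m / (m! (m+N)!)`, which satisfies `I_N(2t) = t^N φ_N(t²)`. -/
def besselAux (N : ℕ) (x : ℝ) : ℝ :=
  ∑' m : ℕ, x ^ m / ((m.factorial : ℝ) * ((m + N).factorial : ℝ))

theorem summable_besselAux (N : ℕ) (x : ℝ) :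
    Summable fun m : ℕ => x ^ m / ((m.factorial : ℝ) * ((m + N).factorial : ℝ)) := by
  refine Summable.of_norm_bounded (Real.summable_pow_div_factorial |x|) fun m => ?_
  rw [norm_div, norm_pow, Real.norm_eq_abs, Real.norm_of_nonneg (by positivity)]
  gcongr
  have : (1 : ℝ) ≤ ((m + N).factorial : ℝ) := by exact_mod_cast Nat.factorial_pos _
  exact le_mul_of_one_le_right (by positivity) this

theorem besselI_two_mul (n : ℤ) (t : ℝ) :
    besselI n (2 * t) = t ^ n.natAbs * besselAux n.natAbs (t ^ 2) := by
  unfold besselI besselAux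
  rw [← tsum_mul_left]
  congr 1; ext m
  have h : Real.Gamma ((m : ℝ) + (n.natAbs : ℝ) + 1) = ((m + n.natAbs).factorial : ℝ) := by
    rw [← Real.Gamma_nat_eq_factorial]; push_cast; rfl
  rw [h, mul_div_cancel_left₀ _ (two_ne_zero), pow_add, ← pow_mul]
  ring

theorem besselAux_nonneg (N : ℕ) {x : ℝ} (hx : 0 ≤ x) : 0 ≤ besselAux N x :=
  tsum_nonneg fun _ => by positivity

theorem besselAux_mono (N : ℕ) {x y : ℝ} (hx : 0 ≤ x) (hxy : x ≤ y) :
    besselAux N x ≤ besselAux N y :=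
  Summable.tsum_le_tsum (fun m => by gcongr) (summable_besselAux N x) (summable_besselAux N y)

/-- From `m! N! ≤ (m+N)!`. The decay `1/N!` makes the Bessel functions summable over the order. -/
theorem besselAux_le (N : ℕ) {x : ℝ} (hx : 0 ≤ x) :
    besselAux N x ≤ besselAux 0 x / (N.factorial : ℝ) := by
  unfold besselAux
  rw [← tsum_div_const]
  refine Summable.tsum_le_tsum (fun m => ?_) (summable_besselAux N x)
    ((summable_besselAux 0 x).div_const _)
  rw [div_div]
  have h : ((m.factorial * N.factorial : ℕ) : ℝ) ≤ ((m + N).factorial : ℕ) := by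
    exact_mod_cast Nat.le_of_dvd (Nat.factorial_pos _)
      (Nat.factorial_mul_factorial_dvd_factorial_add m N)
  push_cast at h
  rw [add_zero, mul_assoc]
  gcongr

/-- Coefficientwise, this is the splitting `m + N + 2 = (N + 1) + (m + 1)` of the last factor of `(m
+ N + 2)!`. -/
theorem besselAux_rec (N : ℕ) (x : ℝ) :
    besselAux N x = (N + 1) * besselAux (N + 1) x + x * besselAux (N + 2) x := by
  have e : ∀ m : ℕ, x ^ (m + 1) / (((m + 1).factorial : ℝ) * ((m + 1 + N).factorial : ℝ)) =
      (N + 1) * (x ^ (m + 1) / (((m + 1).factorial : ℝ) * ((m + 1 + (N + 1)).factorial : ℝ))) +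
      x * (x ^ m / ((m.factorial : ℝ) * ((m + (N + 2)).factorial : ℝ))) := by
    intro m
    have h1 : ((m + 1 + (N + 1)).factorial : ℝ) = (m + N + 2) * ((m + 1 + N).factorial : ℝ) := by
      rw [show m + 1 + (N + 1) = (m + 1 + N) + 1 by ring, Nat.factorial_succ]; push_cast; ring
    have h2 : ((m + (N + 2)).factorial : ℝ) = (m + N + 2) * ((m + 1 + N).factorial : ℝ) := by
      rw [show m + (N + 2) = (m + 1 + N) + 1 by ring, Nat.factorial_succ]; push_cast; ring
    have h3 : ((m + 1).factorial : ℝ) = (m + 1) * (m.factorial : ℝ) := by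
      rw [Nat.factorial_succ]; push_cast; ring
    rw [h1, h2, h3]
    have p1 : (m.factorial : ℝ) ≠ 0 := by positivity
    have p2 : ((m + 1 + N).factorial : ℝ) ≠ 0 := by positivity
    have p3 : (m + N + 2 : ℝ) ≠ 0 := by positivity
    field_simp
    ring
  have s0 := summable_besselAux N x
  have s1 := summable_besselAux (N + 1) x
  have s2 := summable_besselAux (N + 2) x
  unfold besselAux
  rw [s0.tsum_eq_zero_add, s1.tsum_eq_zero_add]
  simp_rw [e]
  rw [Summable.tsum_add (((summable_nat_add_iff 1).2 s1).mul_left _) (s2.mul_left _),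
    tsum_mul_left, tsum_mul_left]
  have p2 : (N.factorial : ℝ) ≠ 0 := by positivity
  have p3 : (N + 1 : ℝ) ≠ 0 := by positivity
  simp only [pow_zero, Nat.factorial_zero, Nat.cast_one, zero_add, one_mul, Nat.factorial_succ,
    Nat.cast_mul, Nat.cast_add]
  field_simp
  ring

theorem hasDerivAt_besselAux (N : ℕ) (x : ℝ) :
    HasDerivAt (besselAux N) (besselAux (N + 1) x) x := by
  set R : ℝ := |x| + 1
  have hR : 0 < R := by positivity
  have key := hasDerivAt_tsum_of_isPreconnected (𝕜 := ℝ)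
    (g := fun (m : ℕ) (y : ℝ) => y ^ m / ((m.factorial : ℝ) * ((m + N).factorial : ℝ)))
    (g' := fun (m : ℕ) (y : ℝ) => m * y ^ (m - 1) / ((m.factorial : ℝ) * ((m + N).factorial : ℝ)))
    (u := fun m : ℕ => m * R ^ (m - 1) / (m.factorial : ℝ)) (t := Ioo (-R) R) (y₀ := 0) (y := x)
    ?_ isOpen_Ioo isPreconnected_Ioo ?_ ?_ ⟨by linarith, hR⟩ (summable_besselAux N 0)
    ⟨by have := neg_abs_le x; simp only [R]; linarith, by have := le_abs_self x; simp only [R]; linarith⟩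
  · refine (key.congr_deriv ?_)
    rw [(Summable.tsum_eq_zero_add (f := fun m : ℕ => (m : ℝ) * x ^ (m - 1) /
      ((m.factorial : ℝ) * ((m + N).factorial : ℝ))))]
    · unfold besselAux
      simp only [Nat.cast_zero, zero_mul, zero_div, zero_add]
      congr 1; ext m
      rw [Nat.factorial_succ, show m + 1 + N = m + (N + 1) by ring]
      have p1 : (m.factorial : ℝ) ≠ 0 := by positivity
      have p2 : ((m + (N + 1)).factorial : ℝ) ≠ 0 := by positivity
      have p3 : (m + 1 : ℝ) ≠ 0 := by positivity
      push_cast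
      field_simp
    · rw [← summable_nat_add_iff 1]
      refine (summable_besselAux (N + 1) x).congr fun m => ?_
      rw [Nat.factorial_succ, show m + 1 + N = m + (N + 1) by ring]
      have p1 : (m.factorial : ℝ) ≠ 0 := by positivity
      have p2 : ((m + (N + 1)).factorial : ℝ) ≠ 0 := by positivity
      have p3 : (m + 1 : ℝ) ≠ 0 := by positivity
      push_cast
      field_simp
  · rw [← summable_nat_add_iff 1]
    refine (Real.summable_pow_div_factorial R).congr fun m => ?_
    rw [Nat.factorial_succ]
    have p1 : (m.factorial : ℝ) ≠ 0 := by positivity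
    have p3 : (m + 1 : ℝ) ≠ 0 := by positivity
    push_cast
    field_simp
  · intro m y _
    exact (hasDerivAt_pow m y).div_const _
  · intro m y hy
    have hyR : |y| ≤ R := abs_le.2 ⟨hy.1.le, hy.2.le⟩
    rw [norm_div, norm_mul, norm_pow, Real.norm_eq_abs, Real.norm_eq_abs,
      Real.norm_of_nonneg (by positivity : 0 ≤ (m.factorial : ℝ) * ((m + N).factorial : ℝ)),
      Nat.abs_cast]
    gcongr
    have : (1 : ℝ) ≤ ((m + N).factorial : ℝ) := by exact_mod_cast Nat.factorial_pos _
    exact le_mul_of_one_le_right (by positivity) this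

theorem besselI_neg (n : ℤ) (t : ℝ) : besselI (-n) t = besselI n t := by
  simp [besselI]

theorem besselI_natCast_succ (N : ℕ) (t : ℝ) :
    besselI ((N : ℤ) + 1) (2 * t) = t ^ (N + 1) * besselAux (N + 1) (t ^ 2) := by
  rw [besselI_two_mul]
  have : ((N : ℤ) + 1).natAbs = N + 1 := by omega
  rw [this]

theorem besselI_natCast (N : ℕ) (t : ℝ) :
    besselI (N : ℤ) (2 * t) = t ^ N * besselAux N (t ^ 2) := by
  rw [besselI_two_mul, Int.natAbs_natCast]

/-- The three-term recurrence `n I_n(2t) = t (I_{n-1}(2t) - I_{n+1}(2t))`. -/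
theorem besselI_rec (n : ℤ) (t : ℝ) :
    n * besselI n (2 * t) = t * (besselI (n - 1) (2 * t) - besselI (n + 1) (2 * t)) := by
  have hnat : ∀ N : ℕ, ((N : ℤ) : ℝ) * besselI N (2 * t) =
      t * (besselI ((N : ℤ) - 1) (2 * t) - besselI ((N : ℤ) + 1) (2 * t)) := by
    intro N
    cases N with
    | zero =>
      have := besselI_neg 1 (2 * t)
      simp [this]
    | succ N =>
      have h1 := besselI_natCast_succ N t
      have h2 := besselI_natCast_succ (N + 1) t
      have h0 := besselI_natCast N t
      push_cast at h1 h2 h0 ⊢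
      rw [add_sub_cancel_right, h0, h1, h2, besselAux_rec N]
      ring
  rcases Int.eq_nat_or_neg n with ⟨N, rfl | rfl⟩
  · exact hnat N
  · have := hnat N
    rw [show -(N : ℤ) - 1 = -((N : ℤ) + 1) by ring, show -(N : ℤ) + 1 = -((N : ℤ) - 1) by ring,
      besselI_neg, besselI_neg, besselI_neg]
    push_cast at this ⊢
    linarith

/-- Follows from `φ_N' = φ_{N+1}` and `besselAux_rec`. Order zero is separate, since there `I_{-1} =
I_1` takes the place of the recurrence. -/
theorem hasDerivAt_besselI (n : ℤ) (t : ℝ) :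
    HasDerivAt (fun s => besselI n (2 * s))
      (besselI (n - 1) (2 * t) + besselI (n + 1) (2 * t)) t := by
  have hnat : ∀ N : ℕ, HasDerivAt (fun s => besselI (N : ℤ) (2 * s))
      (besselI ((N : ℤ) - 1) (2 * t) + besselI ((N : ℤ) + 1) (2 * t)) t := by
    intro N
    have e : (fun s => besselI (N : ℤ) (2 * s)) = fun s => s ^ N * besselAux N (s ^ 2) := by
      ext s; exact besselI_natCast N s
    rw [e]
    have hd := (hasDerivAt_pow N t).mul
      ((hasDerivAt_besselAux N (t ^ 2)).comp t (hasDerivAt_pow 2 t))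
    refine hd.congr_deriv ?_
    cases N with
    | zero =>
      have h1 := besselI_natCast_succ 0 t
      have := besselI_neg 1 (2 * t)
      simp at h1 ⊢
      rw [this, h1]; ring
    | succ N =>
      have h2 := besselI_natCast_succ (N + 1) t
      have h0 := besselI_natCast N t
      have hr := besselAux_rec N (t ^ 2)
      push_cast at h2 h0 ⊢
      rw [add_sub_cancel_right, h0, h2, hr]
      simp only [Function.comp]
      ring
  rcases Int.eq_nat_or_neg n with ⟨N, rfl | rfl⟩
  · exact hnat N
  · simp_rw [show -(N : ℤ) - 1 = -((N : ℤ) + 1) by ring, show -(N : ℤ) + 1 = -((N : ℤ) - 1) by ring,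
      besselI_neg]
    rw [add_comm]
    exact hnat N

theorem besselI_nonneg (n : ℤ) {t : ℝ} (ht : 0 ≤ t) : 0 ≤ besselI n (2 * t) := by
  rw [besselI_two_mul]
  exact mul_nonneg (by positivity) (besselAux_nonneg _ (by positivity))

/-- The power series has nonnegative coefficients. Negative `s` is allowed so that series can be
dominated on intervals around `0`. -/
theorem abs_besselI_le (n : ℤ) {s R : ℝ} (hs : |s| ≤ R) :
    |besselI n (2 * s)| ≤ besselI n (2 * R) := by
  rw [besselI_two_mul, besselI_two_mul, abs_mul, abs_pow,
    abs_of_nonneg (besselAux_nonneg _ (by positivity))]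
  have h : s ^ 2 ≤ R ^ 2 := sq_le_sq' (by linarith [neg_abs_le s]) ((le_abs_self s).trans hs)
  have := besselAux_mono n.natAbs (by positivity) h
  have h0 := besselAux_nonneg n.natAbs (by positivity : 0 ≤ s ^ 2)
  have hR : 0 ≤ R := (abs_nonneg s).trans hs
  gcongr

theorem besselI_mul_zero (n : ℤ) : besselI n (2 * 0) = if n = 0 then 1 else 0 := by
  rw [besselI_two_mul]
  split_ifs with h
  · subst h
    have : besselAux 0 0 = 1 := by
      unfold besselAux
      rw [tsum_eq_single 0 (fun m hm => by simp [hm])]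
      simp
    simp [this]
  · simp [h]

theorem summable_besselI (R : ℝ) (hR : 0 ≤ R) : Summable fun n : ℤ => besselI n (2 * R) := by
  have h : Summable fun N : ℕ => besselI (N : ℤ) (2 * R) := by
    refine Summable.of_nonneg_of_le (fun N => besselI_nonneg _ hR) (fun N => ?_)
      ((Real.summable_pow_div_factorial R).mul_right (besselAux 0 (R ^ 2)))
    rw [besselI_natCast, div_mul_eq_mul_div, mul_div_assoc]
    exact mul_le_mul_of_nonneg_left (besselAux_le N (by positivity)) (by positivity)
  exact Summable.of_nat_of_neg h (by simpa [besselI_neg] using h)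

/-- `I_{N+1} ≤ I_N`, because `I_N² - I_{N+1}²` is nondecreasing on `[0,∞)`. -/
theorem besselI_succ_le (N : ℕ) {t : ℝ} (ht : 0 ≤ t) :
    besselI ((N : ℤ) + 1) (2 * t) ≤ besselI (N : ℤ) (2 * t) := by
  set h : ℝ → ℝ := fun s => besselI (N : ℤ) (2 * s) ^ 2 - besselI ((N : ℤ) + 1) (2 * s) ^ 2
  have hd : ∀ s, HasDerivAt h (2 * besselI (N : ℤ) (2 * s) *
      (besselI ((N : ℤ) - 1) (2 * s) + besselI ((N : ℤ) + 1) (2 * s)) -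
      2 * besselI ((N : ℤ) + 1) (2 * s) *
      (besselI (N : ℤ) (2 * s) + besselI ((N : ℤ) + 2) (2 * s))) s := by
    intro s
    have h1 := (hasDerivAt_besselI (N : ℤ) s).pow 2
    have h2 := (hasDerivAt_besselI ((N : ℤ) + 1) s).pow 2
    rw [add_sub_cancel_right, show (N : ℤ) + 1 + 1 = N + 2 by ring] at h2
    refine (h1.sub h2).congr_deriv ?_
    simp
  have hmono : MonotoneOn h (Ici 0) := by
    refine monotoneOn_of_deriv_nonneg (convex_Ici 0)
      (fun s _ => (hd s).continuousAt.continuousWithinAt)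
      (fun s _ => (hd s).differentiableAt.differentiableWithinAt) fun s hs => ?_
    rw [interior_Ici] at hs
    have hs : 0 < s := hs
    rw [(hd s).deriv]
    have r1 := besselI_rec (N : ℤ) s
    have r2 := besselI_rec ((N : ℤ) + 1) s
    rw [add_sub_cancel_right, show (N : ℤ) + 1 + 1 = N + 2 by ring] at r2
    push_cast at r1 r2
    set a := besselI (N : ℤ) (2 * s)
    set b := besselI ((N : ℤ) + 1) (2 * s)
    -- The two recurrences eliminate `I_{N-1}` and `I_{N+2}`, and the cross terms `4sab` cancel.
    have e : s * (2 * a * (besselI ((N : ℤ) - 1) (2 * s) + b) - 2 * b * (a + besselI ((N : ℤ) + 2) (2 * s)))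
        = 2 * N * a ^ 2 + 2 * (N + 1) * b ^ 2 := by
      linear_combination (-2 * a) * r1 - (2 * b) * r2
    have : 0 ≤ s * (2 * a * (besselI ((N : ℤ) - 1) (2 * s) + b) -
        2 * b * (a + besselI ((N : ℤ) + 2) (2 * s))) := by rw [e]; positivity
    exact nonneg_of_mul_nonneg_right this hs
  have h0 : 0 ≤ h 0 := by
    simp only [h, besselI_mul_zero]
    have : ((N : ℤ) + 1) ≠ 0 := by omega
    simp only [this, if_false]
    split_ifs <;> norm_num
  have := h0.trans (hmono (by simp) ht ht)
  exact le_of_sq_le_sq (by simpa [h] using this) (besselI_nonneg _ ht)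


/-! ### The discrete heat kernel: uniqueness, mass, semigroup law, size -/

/-- The discrete Laplacian `Δ_d`. -/
def lap (w : ℤ → ℝ) (n : ℤ) : ℝ := w (n + 1) - 2 * w n + w (n - 1)

theorem heatKernel_nonneg {t : ℝ} (ht : 0 ≤ t) (n : ℤ) : 0 ≤ heatKernel t n :=
  mul_nonneg (Real.exp_pos _).le (besselI_nonneg n ht)

theorem heatKernel_neg (t : ℝ) (n : ℤ) : heatKernel t (-n) = heatKernel t n := by
  simp only [heatKernel, besselI_neg]

theorem heatKernel_zero (n : ℤ) : heatKernel 0 n = if n = 0 then 1 else 0 := by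
  unfold heatKernel
  rw [besselI_mul_zero]; simp

theorem hasDerivAt_heatKernel (t : ℝ) (n : ℤ) :
    HasDerivAt (fun s => heatKernel s n) (lap (heatKernel t) n) t := by
  have h1 : HasDerivAt (fun s : ℝ => Real.exp (-2 * s)) (Real.exp (-2 * t) * (-2)) t := by
    simpa using ((hasDerivAt_id t).const_mul (-2)).exp
  refine (h1.mul (hasDerivAt_besselI n t)).congr_deriv ?_
  simp only [lap, heatKernel]
  ring

theorem abs_heatKernel_le (n : ℤ) {s R : ℝ} (hs : |s| ≤ R) :
    |heatKernel s n| ≤ Real.exp (4 * R) * heatKernel R n := by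
  have h := abs_besselI_le n hs
  have h2 : Real.exp (-2 * s) ≤ Real.exp (4 * R) * Real.exp (-2 * R) := by
    rw [← Real.exp_add]
    apply Real.exp_le_exp.2
    linarith [neg_abs_le s]
  unfold heatKernel
  rw [abs_mul, Real.abs_exp, ← mul_assoc]
  gcongr

theorem summable_heatKernel {t : ℝ} (ht : 0 ≤ t) : Summable (heatKernel t) :=
  (summable_besselI t ht).mul_left _

theorem summable_heatKernel_sub {t : ℝ} (ht : 0 ≤ t) (n : ℤ) :
    Summable fun j => heatKernel t (n - j) :=
  (Equiv.subLeft n).summable_iff.2 (summable_heatKernel ht)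

/-- A locally bounded solution of the heat equation is given by the heat semigroup. -/
theorem eq_heatSemigroup_of_hasDerivAt (W : ℝ → ℤ → ℝ)
    (hW : ∀ t n, HasDerivAt (fun s => W s n) (lap (W t) n) t)
    (hb : ∀ R, ∃ M, ∀ t, |t| ≤ R → ∀ n, |W t n| ≤ M) (T : ℝ) (n : ℤ) :
    W T n = heatSemigroup T (W 0) n := by
  have hsum : ∀ s m k, Summable fun j : ℤ => heatKernel s (m - j) * W (T - s) (j + k) := by
    intro s m k
    obtain ⟨M, hM⟩ := hb |T - s|
    have hG := ((summable_heatKernel_sub (abs_nonneg s) m).mul_left (Real.exp (4 * |s|))).mul_right M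
    refine hG.of_norm_bounded fun j => ?_
    rw [norm_mul]
    exact mul_le_mul (abs_heatKernel_le _ le_rfl) (hM _ le_rfl _) (abs_nonneg _)
      (mul_nonneg (Real.exp_pos _).le (heatKernel_nonneg (abs_nonneg s) _))
  -- Duhamel's argument: `∑_j G(s,n-j) W(T-s,j)` does not depend on `s`, as `Δ` is symmetric. Its
  -- values at `s = 0` and `s = T` are the two sides of the claim.
  have hd : ∀ s, HasDerivAt (fun s => ∑' j : ℤ, heatKernel s (n - j) * W (T - s) j) 0 s := by
    intro s
    set R := |s| + |T| + 1
    have hR : 0 < R := by positivity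
    obtain ⟨M, hM⟩ := hb (|T| + R)
    have hM0 : 0 ≤ M := (abs_nonneg _).trans (hM 0 (by simp; positivity) 0)
    set E := Real.exp (4 * R)
    have key := hasDerivAt_tsum_of_isPreconnected (𝕜 := ℝ)
      (g := fun (j : ℤ) (s : ℝ) => heatKernel s (n - j) * W (T - s) j)
      (g' := fun (j : ℤ) (s : ℝ) => lap (heatKernel s) (n - j) * W (T - s) j -
        heatKernel s (n - j) * lap (W (T - s)) j)
      (u := fun j => E * (heatKernel R (n + 1 - j) + 2 * heatKernel R (n - j) +
        heatKernel R (n - 1 - j)) * M + E * heatKernel R (n - j) * (4 * M))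
      (t := Ioo (-R) R) (y₀ := 0) (y := s) ?_ isOpen_Ioo isPreconnected_Ioo ?_ ?_
      ⟨by linarith, hR⟩ (by simpa using hsum 0 n 0)
      ⟨by linarith [neg_abs_le s, abs_nonneg T], by linarith [le_abs_self s, abs_nonneg T]⟩
    · refine key.congr_deriv ?_
      have hx := hsum s n 1
      have hy := hsum s n (-1)
      have hx' : Summable fun j : ℤ => heatKernel s (n - (Equiv.subRight (1 : ℤ)) j) *
          W (T - s) ((Equiv.subRight (1 : ℤ)) j + 1) := (Equiv.subRight (1 : ℤ)).summable_iff.2 hx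
      have hy' : Summable fun j : ℤ => heatKernel s (n - (Equiv.addRight (1 : ℤ)) j) *
          W (T - s) ((Equiv.addRight (1 : ℤ)) j + -1) := (Equiv.addRight (1 : ℤ)).summable_iff.2 hy
      have ex := (Equiv.subRight (1 : ℤ)).tsum_eq
        (fun j : ℤ => heatKernel s (n - j) * W (T - s) (j + 1))
      have ey := (Equiv.addRight (1 : ℤ)).tsum_eq
        (fun j : ℤ => heatKernel s (n - j) * W (T - s) (j + -1))
      -- Summation by parts: each bracket is a summable function of `j` minus its translate, so it
      -- sums to zero.
      have e : ∀ j : ℤ, lap (heatKernel s) (n - j) * W (T - s) j -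
          heatKernel s (n - j) * lap (W (T - s)) j =
          (heatKernel s (n - (Equiv.subRight (1 : ℤ)) j) * W (T - s) ((Equiv.subRight (1 : ℤ)) j + 1) -
            heatKernel s (n - j) * W (T - s) (j + 1)) +
          (heatKernel s (n - (Equiv.addRight (1 : ℤ)) j) * W (T - s) ((Equiv.addRight (1 : ℤ)) j + -1) -
            heatKernel s (n - j) * W (T - s) (j + -1)) := by
        intro j
        simp only [Equiv.subRight_apply, Equiv.coe_addRight, lap, sub_add_cancel,
          add_neg_cancel_right]
        rw [show n - (j - 1) = n - j + 1 by ring, show n - (j + 1) = n - j - 1 by ring,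
          show j + -1 = j - 1 by ring]
        ring
      simp_rw [e]
      rw [Summable.tsum_add (hx'.sub hx) (hy'.sub hy), Summable.tsum_sub hx' hx,
        Summable.tsum_sub hy' hy, ex, ey]
      simp
    · have h0 := summable_heatKernel_sub hR.le
      exact (((((h0 (n + 1)).add ((h0 n).mul_left 2)).add (h0 (n - 1))).mul_left E).mul_right M).add
        (((h0 n).mul_left E).mul_right (4 * M))
    · intro j y _
      have h2 : HasDerivAt (fun s => W (T - s) j) (-lap (W (T - y)) j) y := (hW (T - y) j).comp_const_sub T y
      refine ((hasDerivAt_heatKernel y (n - j)).mul h2).congr_deriv ?_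
      ring
    · intro j y hy
      have hyR : |y| ≤ R := abs_le.2 ⟨hy.1.le, hy.2.le⟩
      have hTy : |T - y| ≤ |T| + R := (abs_sub _ _).trans (by linarith)
      have b1 : |lap (heatKernel y) (n - j)| ≤ E * (heatKernel R (n + 1 - j) +
          2 * heatKernel R (n - j) + heatKernel R (n - 1 - j)) := by
        have c1 := abs_heatKernel_le (n - j + 1) hyR
        have c2 := abs_heatKernel_le (n - j) hyR
        have c3 := abs_heatKernel_le (n - j - 1) hyR
        rw [show n + 1 - j = n - j + 1 by ring, show n - 1 - j = n - j - 1 by ring]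
        unfold lap
        rw [abs_le] at *
        constructor <;> linarith
      have b2 : |lap (W (T - y)) j| ≤ 4 * M := by
        have c1 := hM _ hTy (j + 1)
        have c2 := hM _ hTy j
        have c3 := hM _ hTy (j - 1)
        unfold lap
        rw [abs_le] at *
        constructor <;> linarith
      refine (norm_sub_le _ _).trans ?_
      rw [norm_mul, norm_mul]
      have g0 := heatKernel_nonneg hR.le
      refine add_le_add (mul_le_mul b1 (hM _ hTy _) (abs_nonneg _) ((abs_nonneg _).trans b1))
        (mul_le_mul (abs_heatKernel_le _ hyR) b2 (abs_nonneg _)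
          (mul_nonneg (Real.exp_pos _).le (g0 _)))
  have hc := is_const_of_deriv_eq_zero (fun s => (hd s).differentiableAt)
    (fun s => (hd s).deriv) 0 T
  simp only [sub_zero, sub_self] at hc
  unfold heatSemigroup
  rw [← hc, tsum_eq_single n]
  · simp [heatKernel_zero]
  · intro j hj
    have : n - j ≠ 0 := by omega
    simp [heatKernel_zero, this]

/-- The constant `1` is a bounded solution of the heat equation, so uniqueness applies. -/
theorem tsum_heatKernel (t : ℝ) : ∑' j, heatKernel t j = 1 := by
  have := eq_heatSemigroup_of_hasDerivAt (fun _ _ => 1)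
    (fun t n => by simpa [lap] using (hasDerivAt_const t (1 : ℝ)).congr_deriv (by norm_num))
    (fun R => ⟨1, by simp⟩) t 0
  rw [this]
  unfold heatSemigroup
  simp only [mul_one]
  exact ((Equiv.subLeft (0 : ℤ)).tsum_eq (heatKernel t)).symm

theorem heatKernel_le_one {t : ℝ} (ht : 0 ≤ t) (n : ℤ) : heatKernel t n ≤ 1 := by
  rw [← tsum_heatKernel t]
  exact (summable_heatKernel ht).le_tsum n fun j _ => heatKernel_nonneg ht j

/-- Uniqueness applied to the solution `s ↦ G(s+t,·)`. -/
theorem heatKernel_add (s t : ℝ) (n : ℤ) :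
    heatKernel (s + t) n = ∑' j, heatKernel s (n - j) * heatKernel t j := by
  have := eq_heatSemigroup_of_hasDerivAt (fun s n => heatKernel (s + t) n)
    (fun s n => (hasDerivAt_heatKernel (s + t) n).comp_add_const s t)
    (fun R => ⟨Real.exp (4 * (R + |t|)), fun s hs m => ?_⟩) s n
  · simpa [heatSemigroup] using this
  · have hR : |s + t| ≤ R + |t| := (abs_add_le _ _).trans (by linarith)
    refine (abs_heatKernel_le m hR).trans ?_
    have := heatKernel_le_one ((abs_nonneg _).trans hR) m
    nlinarith [Real.exp_pos (4 * (R + |t|))]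

theorem heatKernel_rec (n : ℤ) (t : ℝ) :
    n * heatKernel t n = t * (heatKernel t (n - 1) - heatKernel t (n + 1)) := by
  have := besselI_rec n t
  unfold heatKernel
  linear_combination Real.exp (-2 * t) * this

theorem heatKernel_antitone {t : ℝ} (ht : 0 ≤ t) : Antitone fun N : ℕ => heatKernel t (N : ℤ) := by
  refine antitone_nat_of_succ_le fun N => ?_
  have := besselI_succ_le N ht
  unfold heatKernel
  push_cast
  gcongr

theorem heatKernel_natAbs (t : ℝ) (n : ℤ) : heatKernel t n = heatKernel t (n.natAbs : ℤ) := by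
  rcases Int.natAbs_eq n with h | h
  · rw [← h]
  · conv_lhs => rw [h, heatKernel_neg]

theorem heatKernel_le_of_natAbs_le {t : ℝ} (ht : 0 ≤ t) {m n : ℤ} (h : m.natAbs ≤ n.natAbs) :
    heatKernel t n ≤ heatKernel t m := by
  rw [heatKernel_natAbs t n, heatKernel_natAbs t m]
  exact heatKernel_antitone ht h

/-- Each of the `|n| + 1` values `G(t,0), …, G(t,|n|)` is at least `G(t,n)`, and the total mass is
one. -/
theorem mul_heatKernel_le_one {t : ℝ} (ht : 0 ≤ t) (n : ℤ) : (1 + |(n : ℝ)|) * heatKernel t n ≤ 1 := by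
  have h1 : ∑ N ∈ Finset.range (n.natAbs + 1), heatKernel t (N : ℤ) ≤ 1 := by
    rw [← tsum_heatKernel t]
    have := (summable_heatKernel ht).sum_le_tsum
      ((Finset.range (n.natAbs + 1)).map ⟨((↑) : ℕ → ℤ), Nat.cast_injective⟩)
      (fun j _ => heatKernel_nonneg ht j)
    simpa using this
  have h2 : ∑ N ∈ Finset.range (n.natAbs + 1), heatKernel t n ≤ 1 := by
    refine (Finset.sum_le_sum fun N hN => ?_).trans h1
    apply heatKernel_le_of_natAbs_le ht
    simp at hN ⊢
    omega
  have h3 : ((n.natAbs : ℕ) : ℝ) = |(n : ℝ)| := by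
    rw [Nat.cast_natAbs, Int.cast_abs]
  simp only [Finset.sum_const, Finset.card_range, nsmul_eq_mul, Nat.cast_add, Nat.cast_one, h3] at h2
  linarith

/-- The recurrence at `m = 2N+1` gives `G(t,2N) - G(t,2N+2) = (m/t) G(t,m) ≤ (m/t) G(t,0)`, and the
first `N` odd numbers sum to `N²`. Only even points occur because the recurrence moves by two. -/
theorem heatKernel_two_mul_ge {t : ℝ} (ht : 0 < t) (N : ℕ) :
    heatKernel t 0 * (1 - (N : ℝ) ^ 2 / t) ≤ heatKernel t ((2 * N : ℕ) : ℤ) := by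
  induction N with
  | zero => simp
  | succ N ih =>
    have h := heatKernel_rec (2 * N + 1) t
    have h1 : heatKernel t (2 * N + 1) ≤ heatKernel t 0 :=
      heatKernel_le_of_natAbs_le ht.le (by simp)
    rw [show (2 * (N : ℤ) + 1 - 1) = 2 * N by ring, show (2 * (N : ℤ) + 1 + 1) = 2 * (N + 1) by ring]
      at h
    push_cast at h ih ⊢
    have h2 : heatKernel t (2 * N) - heatKernel t (2 * (N + 1)) ≤
        (2 * N + 1) / t * heatKernel t 0 := by
      rw [div_mul_eq_mul_div, le_div_iff₀ ht, mul_comm, ← h]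
      gcongr
    have e : heatKernel t 0 * (1 - ((N : ℝ) + 1) ^ 2 / t) =
      heatKernel t 0 * (1 - (N : ℝ) ^ 2 / t) - (2 * N + 1) / t * heatKernel t 0 := by ring
    rw [e]; linarith

/-- The diagonal bound `G(t,n) ≤ 4 t^{-1/2}`. -/
theorem heatKernel_le_rpow {t : ℝ} (ht : 0 < t) (n : ℤ) : heatKernel t n ≤ 4 * t ^ (-(1 / 2) : ℝ) := by
  refine (heatKernel_le_of_natAbs_le ht.le (m := 0) (by simp)).trans ?_
  -- For `N ≤ r` the lower bound gives `G(t,2N) ≥ G(t,0)/2`. There are more than `r` such `N`, so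
  -- mass one forces `r G(t,0) ≤ 2`.
  set r := Real.sqrt (t / 2)
  have hr : 0 < r := Real.sqrt_pos.2 (by positivity)
  have hr2 : r ^ 2 = t / 2 := Real.sq_sqrt (by positivity)
  have h0 := heatKernel_nonneg ht.le 0
  have h1 : ∑ N ∈ Finset.range (⌊r⌋₊ + 1), heatKernel t ((2 * N : ℕ) : ℤ) ≤ 1 := by
    rw [← tsum_heatKernel t]
    have hinj : Function.Injective fun N : ℕ => ((2 * N : ℕ) : ℤ) := by
      intro a b hab
      simp at hab
      exact hab
    have := (summable_heatKernel ht.le).sum_le_tsum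
      ((Finset.range (⌊r⌋₊ + 1)).map ⟨fun N : ℕ => ((2 * N : ℕ) : ℤ), hinj⟩)
      (fun j _ => heatKernel_nonneg ht.le j)
    simpa using this
  have h2 : ∑ N ∈ Finset.range (⌊r⌋₊ + 1), heatKernel t 0 * (1 / 2) ≤ 1 := by
    refine (Finset.sum_le_sum fun N hN => ?_).trans h1
    refine le_trans ?_ (heatKernel_two_mul_ge ht N)
    have hN' : (N : ℝ) ≤ r :=
      (Nat.cast_le.2 (Nat.lt_succ_iff.1 (Finset.mem_range.1 hN))).trans (Nat.floor_le hr.le)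
    have : (N : ℝ) ^ 2 / t ≤ 1 / 2 := by
      rw [div_le_iff₀ ht]
      nlinarith [pow_le_pow_left₀ (Nat.cast_nonneg N) hN' 2]
    gcongr
    linarith
  simp only [Finset.sum_const, Finset.card_range, nsmul_eq_mul, Nat.cast_add, Nat.cast_one] at h2
  have h3 : r * heatKernel t 0 ≤ 2 := by nlinarith [Nat.lt_floor_add_one r]
  have h4 : t ^ (-(1 / 2) : ℝ) = 1 / Real.sqrt t := by
    rw [Real.rpow_neg ht.le, ← Real.sqrt_eq_rpow, one_div]
  rw [h4]
  have hs : 0 < Real.sqrt t := Real.sqrt_pos.2 ht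
  have h5 : Real.sqrt t ≤ 2 * r := by
    apply Real.sqrt_le_iff.2
    constructor
    · positivity
    · nlinarith
  rw [mul_one_div, le_div_iff₀ hs]
  nlinarith

/-- The kernel is even and decreasing in `|n|`, so the sum telescopes on each half-line and each
contributes at most `G(t,0)`. -/
theorem tsum_abs_heatKernel_sub_le {t : ℝ} (ht : 0 ≤ t) :
    (Summable fun n => |heatKernel t (n + 1) - heatKernel t n|) ∧
    ∑' n, |heatKernel t (n + 1) - heatKernel t n| ≤ 2 * heatKernel t 0 := by
  have hs : Summable fun n => |heatKernel t (n + 1) - heatKernel t n| :=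
    (((Equiv.addRight (1 : ℤ)).summable_iff.2 (summable_heatKernel ht)).sub
      (summable_heatKernel ht)).abs
  refine ⟨hs, ?_⟩
  set a : ℕ → ℝ := fun N => heatKernel t N - heatKernel t ((N : ℤ) + 1)
  have ha0 : ∀ N, 0 ≤ a N := fun N => by
    have := heatKernel_antitone ht (Nat.le_succ N)
    simp only [Nat.succ_eq_add_one, Nat.cast_add, Nat.cast_one] at this
    simp only [a]; linarith
  have hat : ∀ K, ∑ N ∈ Finset.range K, a N ≤ heatKernel t 0 := by
    intro K
    have := Finset.sum_range_sub' (fun N : ℕ => heatKernel t (N : ℤ)) K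
    simp only [Nat.cast_add, Nat.cast_one, Nat.cast_zero] at this
    simp only [a]
    rw [this]
    linarith [heatKernel_nonneg ht (K : ℤ)]
  have hasum : Summable a := summable_of_sum_range_le ha0 hat
  have hale : ∑' N, a N ≤ heatKernel t 0 := hasum.tsum_le_of_sum_range_le hat
  have e1 : ∀ N : ℕ, |heatKernel t ((N : ℤ) + 1) - heatKernel t N| = a N := fun N => by
    rw [abs_sub_comm, abs_of_nonneg (ha0 N)]
  have e2 : ∀ N : ℕ, |heatKernel t (-((N : ℤ) + 1) + 1) - heatKernel t (-((N : ℤ) + 1))| = a N :=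
    fun N => by
      rw [show -((N : ℤ) + 1) + 1 = -(N : ℤ) by ring, heatKernel_neg, heatKernel_neg,
        abs_of_nonneg (ha0 N)]
  have h1 : HasSum (fun N : ℕ => |heatKernel t ((N : ℤ) + 1) - heatKernel t N|) (∑' N, a N) := by
    simp_rw [e1]; exact hasum.hasSum
  have h2 : HasSum (fun N : ℕ => |heatKernel t (-((N : ℤ) + 1) + 1) - heatKernel t (-((N : ℤ) + 1))|)
      (∑' N, a N) := by
    simp_rw [e2]; exact hasum.hasSum
  have := HasSum.of_nat_of_neg_add_one (f := fun n : ℤ => |heatKernel t (n + 1) - heatKernel t n|) h1 h2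
  rw [this.tsum_eq]
  linarith


/-! ### The heat semigroup on functions with absolutely convergent series -/

section

/-- The functions on which the heat semigroup acts by absolutely convergent series. -/
def HeatSummable (h : ℤ → ℝ) : Prop :=
  ∀ t, 0 < t → ∀ n, Summable fun j => heatKernel t (n - j) * |h j|

/-- The forward difference. -/
def fwd (w : ℤ → ℝ) (n : ℤ) : ℝ := w (n + 1) - w n

theorem lap_eq_fwd_fwd (w : ℤ → ℝ) (n : ℤ) : lap w n = fwd (fwd w) (n - 1) := by
  unfold lap fwd
  rw [sub_add_cancel]; ring

variable {h : ℤ → ℝ}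

theorem HeatSummable.summable (hh : HeatSummable h) {t : ℝ} (ht : 0 < t) (n : ℤ) :
    Summable fun j => heatKernel t (n - j) * h j := by
  refine (hh t ht n).of_norm_bounded fun j => ?_
  rw [norm_mul, Real.norm_of_nonneg (heatKernel_nonneg ht.le _), Real.norm_eq_abs]

theorem HeatSummable.abs (hh : HeatSummable h) : HeatSummable fun j => |h j| := by
  intro t ht n
  simpa using hh t ht n

theorem HeatSummable.mono {g : ℤ → ℝ} (hh : HeatSummable h) (hg : ∀ n, |g n| ≤ h n) :
    HeatSummable g := by
  intro t ht n
  refine (hh.summable ht n).of_nonneg_of_le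
    (fun j => mul_nonneg (heatKernel_nonneg ht.le _) (abs_nonneg _)) fun j => ?_
  exact mul_le_mul_of_nonneg_left (hg j) (heatKernel_nonneg ht.le _)

theorem HeatSummable.add {g : ℤ → ℝ} (hh : HeatSummable h) (hg : HeatSummable g) :
    HeatSummable fun n => h n + g n := by
  have : HeatSummable fun n => |h n| + |g n| := by
    intro t ht n
    refine ((hh t ht n).add (hg t ht n)).congr fun j => ?_
    rw [abs_of_nonneg (by positivity : 0 ≤ |h j| + |g j|)]; ring
  exact this.mono fun n => abs_add_le _ _

theorem HeatSummable.const_mul (hh : HeatSummable h) (c : ℝ) :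
    HeatSummable fun n => c * h n := by
  intro t ht n
  refine ((hh t ht n).mul_left |c|).congr fun j => ?_
  rw [abs_mul]; ring

theorem HeatSummable.shift (hh : HeatSummable h) (k : ℤ) : HeatSummable fun n => h (n + k) := by
  intro t ht n
  refine ((Equiv.addRight k).summable_iff.2 (hh t ht (n + k))).congr fun j => ?_
  simp

theorem HeatSummable.fwd (hh : HeatSummable h) : HeatSummable (fwd h) := by
  have := (hh.shift 1).add (hh.const_mul (-1))
  refine this.abs.mono fun n => ?_
  simp [DiscreteBesov.fwd, sub_eq_add_neg]

theorem HeatSummable.lap (hh : HeatSummable h) : HeatSummable (lap h) := by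
  have : DiscreteBesov.lap h = fun n => DiscreteBesov.fwd (DiscreteBesov.fwd h) (n + -1) := by
    ext n; rw [lap_eq_fwd_fwd]; rfl
  rw [this]
  exact hh.fwd.fwd.shift (-1)

theorem HeatSummable.iterate_lap (hh : HeatSummable h) (k : ℕ) :
    HeatSummable (DiscreteBesov.lap^[k] h) := by
  induction k with
  | zero => exact hh
  | succ k ih => rw [Function.iterate_succ_apply']; exact ih.lap

theorem heatSemigroup_shift (t : ℝ) (h : ℤ → ℝ) (k n : ℤ) :
    heatSemigroup t (fun j => h (j + k)) n = heatSemigroup t h (n + k) := by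
  unfold heatSemigroup
  rw [← (Equiv.subRight k).tsum_eq (fun j => heatKernel t (n - j) * h (j + k))]
  congr 1; ext j
  simp only [Equiv.subRight_apply, sub_add_cancel]
  rw [show n - (j - k) = n + k - j by ring]

theorem heatSemigroup_fwd (hh : HeatSummable h) {t : ℝ} (ht : 0 < t) :
    heatSemigroup t (fwd h) = fwd (heatSemigroup t h) := by
  ext n
  unfold fwd
  rw [← heatSemigroup_shift]
  unfold heatSemigroup
  rw [← Summable.tsum_sub ((hh.shift 1).summable ht n) (hh.summable ht n)]
  simp_rw [mul_sub]

theorem heatSemigroup_lap (hh : HeatSummable h) {t : ℝ} (ht : 0 < t) :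
    heatSemigroup t (lap h) = lap (heatSemigroup t h) := by
  ext n
  have : lap h = fun n => fwd (fwd h) (n + -1) := by
    ext n; rw [lap_eq_fwd_fwd]; rfl
  rw [lap_eq_fwd_fwd, this, heatSemigroup_shift, heatSemigroup_fwd hh.fwd ht,
    heatSemigroup_fwd hh ht]
  rfl

theorem heatSemigroup_iterate_lap (hh : HeatSummable h) {t : ℝ} (ht : 0 < t) (k : ℕ) :
    heatSemigroup t (lap^[k] h) = lap^[k] (heatSemigroup t h) := by
  induction k with
  | zero => rfl
  | succ k ih =>
    rw [Function.iterate_succ_apply', Function.iterate_succ_apply',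
      heatSemigroup_lap (hh.iterate_lap k) ht, ih]

/-- Termwise differentiation on `(0,2t)`, dominated by the kernel at the later time `2t`;
`HeatSummable` asks for convergence at all times, so the majorant is summable. -/
theorem hasDerivAt_heatSemigroup (hh : HeatSummable h) {t : ℝ} (ht : 0 < t) (n : ℤ) :
    HasDerivAt (fun s => heatSemigroup s h n) (lap (heatSemigroup t h) n) t := by
  set R := 2 * t
  have hR : 0 < R := by positivity
  set E := Real.exp (4 * R)
  have key := hasDerivAt_tsum_of_isPreconnected (𝕜 := ℝ)
    (g := fun (j : ℤ) (s : ℝ) => heatKernel s (n - j) * h j)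
    (g' := fun (j : ℤ) (s : ℝ) => lap (heatKernel s) (n - j) * h j)
    (u := fun j => E * (heatKernel R (n + 1 - j) * |h j| + 2 * (heatKernel R (n - j) * |h j|) +
      heatKernel R (n - 1 - j) * |h j|))
    (t := Ioo 0 R) (y₀ := t) (y := t) ?_ isOpen_Ioo isPreconnected_Ioo ?_ ?_
    ⟨ht, by simp only [R]; linarith⟩ (hh.summable ht n) ⟨ht, by simp only [R]; linarith⟩
  · refine key.congr_deriv ?_
    have e : ∀ j, lap (heatKernel t) (n - j) * h j = heatKernel t (n + 1 - j) * h j -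
        2 * (heatKernel t (n - j) * h j) + heatKernel t (n - 1 - j) * h j := by
      intro j
      rw [show n + 1 - j = n - j + 1 by ring, show n - 1 - j = n - j - 1 by ring]
      unfold lap; ring
    simp_rw [e]
    rw [Summable.tsum_add ((hh.summable ht (n + 1)).sub ((hh.summable ht n).mul_left 2))
      (hh.summable ht (n - 1)), Summable.tsum_sub (hh.summable ht (n + 1))
      ((hh.summable ht n).mul_left 2), tsum_mul_left]
    rfl
  · exact (((hh R hR (n + 1)).add ((hh R hR n).mul_left 2)).add (hh R hR (n - 1))).mul_left E
  · intro j y _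
    exact (hasDerivAt_heatKernel y (n - j)).mul_const _
  · intro j y hy
    have hyR : |y| ≤ R := abs_le.2 ⟨by linarith [hy.1], hy.2.le⟩
    have c1 := abs_heatKernel_le (n - j + 1) hyR
    have c2 := abs_heatKernel_le (n - j) hyR
    have c3 := abs_heatKernel_le (n - j - 1) hyR
    have b1 : |lap (heatKernel y) (n - j)| ≤ E * (heatKernel R (n + 1 - j) +
        2 * heatKernel R (n - j) + heatKernel R (n - 1 - j)) := by
      rw [show n + 1 - j = n - j + 1 by ring, show n - 1 - j = n - j - 1 by ring]
      unfold lap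
      rw [abs_le] at *
      constructor <;> linarith
    rw [norm_mul, Real.norm_eq_abs, Real.norm_eq_abs]
    refine (mul_le_mul_of_nonneg_right b1 (abs_nonneg _)).trans (le_of_eq ?_)
    ring

/-- `Δ` is a finite combination of translations, hence commutes with `d/dt`; each time derivative of
a solution adds one Laplacian. -/
theorem hasDerivAt_iterate_lap {W : ℝ → ℤ → ℝ} {t : ℝ}
    (hW : ∀ n, HasDerivAt (fun s => W s n) (lap (W t) n) t) (k : ℕ) (n : ℤ) :
    HasDerivAt (fun s => (lap^[k] (W s)) n) ((lap^[k + 1] (W t)) n) t := by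
  induction k generalizing n with
  | zero => exact hW n
  | succ k ih =>
    rw [Function.iterate_succ_apply' lap (k + 1)]
    have e : (fun s => (lap^[k + 1] (W s)) n) = fun s => lap (lap^[k] (W s)) n := by
      funext s; rw [Function.iterate_succ_apply']
    rw [e]
    exact ((ih (n + 1)).sub ((ih n).const_mul 2)).add (ih (n - 1))

theorem iteratedDeriv_heatSemigroup (hh : HeatSummable h) (k : ℕ) {t : ℝ} (ht : 0 < t) (n : ℤ) :
    iteratedDeriv k (fun s => heatSemigroup s h n) t = (lap^[k] (heatSemigroup t h)) n := by
  induction k generalizing t with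
  | zero => simp
  | succ k ih =>
    rw [iteratedDeriv_succ]
    have : iteratedDeriv k (fun s => heatSemigroup s h n) =ᶠ[nhds t]
        fun s => (lap^[k] (heatSemigroup s h)) n := by
      filter_upwards [Ioi_mem_nhds ht] with s hs using ih hs
    rw [this.deriv_eq]
    exact (hasDerivAt_iterate_lap (fun n => hasDerivAt_heatSemigroup hh ht n) k n).deriv

theorem abs_heatSemigroup_le (hh : HeatSummable h) {t : ℝ} (ht : 0 < t) (n : ℤ) :
    |heatSemigroup t h n| ≤ heatSemigroup t (fun j => |h j|) n := by
  unfold heatSemigroup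
  refine (norm_tsum_le_tsum_norm (hh.summable ht n).norm).trans (le_of_eq ?_)
  congr 1; ext j
  rw [norm_mul, Real.norm_of_nonneg (heatKernel_nonneg ht.le _), Real.norm_eq_abs]

theorem hasSum_heatKernel_mul (s t : ℝ) (hs : 0 ≤ s) (ht : 0 ≤ t) (n i : ℤ) :
    HasSum (fun j => heatKernel s (n - j) * heatKernel t (j - i)) (heatKernel (s + t) (n - i)) := by
  have hsum : Summable fun j => heatKernel s (n - i - j) * heatKernel t j := by
    refine (summable_heatKernel ht).of_nonneg_of_le
      (fun j => mul_nonneg (heatKernel_nonneg hs _) (heatKernel_nonneg ht _)) fun j => ?_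
    exact mul_le_of_le_one_left (heatKernel_nonneg ht _) (heatKernel_le_one hs _)
  have h1 := hsum.hasSum
  rw [← heatKernel_add] at h1
  simpa [Function.comp_def] using (Equiv.subRight i).hasSum_iff.2 h1

/-- By nonnegativity it is enough to sum over the intermediate point first, which by the semigroup
law leaves the series at time `s + t`. This licenses the interchange in `heatSemigroup_add`. -/
theorem summable_heatKernel_mul_prod (hh : HeatSummable h) {s t : ℝ} (hs : 0 < s) (ht : 0 < t)
    (n : ℤ) : Summable fun x : ℤ × ℤ =>
      heatKernel s (n - x.1) * (heatKernel t (x.1 - x.2) * |h x.2|) := by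
  rw [← (Equiv.prodComm ℤ ℤ).summable_iff]
  have e : ∀ i, HasSum (fun j => heatKernel s (n - j) * (heatKernel t (j - i) * |h i|))
      (heatKernel (s + t) (n - i) * |h i|) := fun i => by
    simpa only [mul_assoc] using (hasSum_heatKernel_mul s t hs.le ht.le n i).mul_right |h i|
  refine (summable_prod_of_nonneg fun x => mul_nonneg (heatKernel_nonneg hs.le _)
    (mul_nonneg (heatKernel_nonneg ht.le _) (abs_nonneg _))).2 ⟨fun i => (e i).summable, ?_⟩
  refine (hh (s + t) (by positivity) n).congr fun i => ?_
  exact (e i).tsum_eq.symm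

theorem heatSemigroup_add (hh : HeatSummable h) {s t : ℝ} (hs : 0 < s) (ht : 0 < t) (n : ℤ) :
    heatSemigroup s (heatSemigroup t h) n = heatSemigroup (s + t) h n := by
  have hp : Summable fun x : ℤ × ℤ =>
      heatKernel s (n - x.1) * (heatKernel t (x.1 - x.2) * h x.2) := by
    refine (summable_heatKernel_mul_prod hh hs ht n).of_norm_bounded fun x => ?_
    rw [norm_mul, norm_mul, Real.norm_of_nonneg (heatKernel_nonneg hs.le _),
      Real.norm_of_nonneg (heatKernel_nonneg ht.le _), Real.norm_eq_abs]
  unfold heatSemigroup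
  simp_rw [← tsum_mul_left]
  rw [Summable.tsum_comm (f := fun i j => heatKernel s (n - j) * (heatKernel t (j - i) * h i))]
  · congr 1; ext i
    simp_rw [← mul_assoc]
    rw [tsum_mul_right, (hasSum_heatKernel_mul s t hs.le ht.le n i).tsum_eq]
  · exact (Equiv.prodComm ℤ ℤ).summable_iff.2 hp

theorem HeatSummable.heatSemigroup (hh : HeatSummable h) {t : ℝ} (ht : 0 < t) :
    HeatSummable (heatSemigroup t h) := by
  have : HeatSummable (DiscreteBesov.heatSemigroup t fun j => |h j|) := by
    intro s hs n
    have hn : ∀ j, 0 ≤ DiscreteBesov.heatSemigroup t (fun j => |h j|) j := fun j =>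
      tsum_nonneg fun i => mul_nonneg (heatKernel_nonneg ht.le _) (abs_nonneg _)
    simp_rw [abs_of_nonneg (hn _)]
    refine (summable_heatKernel_mul_prod hh hs ht n).prod.congr fun j => ?_
    dsimp only
    rw [tsum_mul_left]
    rfl
  exact this.mono fun n => abs_heatSemigroup_le hh ht n

theorem fwd_heatSemigroup (hh : HeatSummable h) {t : ℝ} (ht : 0 < t) (n : ℤ) :
    fwd (heatSemigroup t h) n = ∑' j, fwd (heatKernel t) (n - j) * h j := by
  unfold fwd heatSemigroup
  rw [← Summable.tsum_sub (hh.summable ht (n + 1)) (hh.summable ht n)]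
  congr 1; ext j
  rw [show n + 1 - j = n - j + 1 by ring]; ring

end


/-! ### Minkowski, Schur and Young inequalities; smoothing by the semigroup -/

section

section Minkowski

variable {X Y : Type*} [MeasurableSpace X] [MeasurableSpace Y] {μ : Measure X} {ν : Measure Y}

/-- Jensen's inequality for the measure with density `a`. -/
theorem rpow_lintegral_mul_le {a b : Y → ℝ≥0∞} (ha : AEMeasurable a ν) (hb : AEMeasurable b ν)
    {r : ℝ} (hr : 1 ≤ r) :
    (∫⁻ y, a y * b y ∂ν) ^ r ≤ (∫⁻ y, a y ∂ν) ^ (r - 1) * ∫⁻ y, a y * b y ^ r ∂ν := by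
  have hr0 : 0 < r := by linarith
  have h1 : 0 ≤ 1 - 1 / r := by
    rw [sub_nonneg, div_le_one hr0]; exact hr
  -- Prepares Hölder's inequality with weights `1 - 1/r` on `a` and `1/r` on `a b^r`.
  have e : ∀ y, a y * b y = a y ^ (1 - 1 / r) * (a y * b y ^ r) ^ (1 / r) := by
    intro y
    rw [ENNReal.mul_rpow_of_nonneg _ _ (by positivity), ← mul_assoc,
      ← ENNReal.rpow_add_of_nonneg _ _ h1 (by positivity), ← ENNReal.rpow_mul,
      mul_one_div_cancel hr0.ne', sub_add_cancel, ENNReal.rpow_one, ENNReal.rpow_one]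
  have h2 := ENNReal.lintegral_mul_norm_pow_le ha (ha.mul (hb.pow_const r)) h1
    (by positivity : 0 ≤ 1 / r) (by ring)
  simp_rw [e]
  refine (ENNReal.rpow_le_rpow h2 hr0.le).trans (le_of_eq ?_)
  rw [ENNReal.mul_rpow_of_nonneg _ _ hr0.le, ← ENNReal.rpow_mul, ← ENNReal.rpow_mul,
    one_div_mul_cancel hr0.ne', ENNReal.rpow_one, sub_mul, one_mul, one_div_mul_cancel hr0.ne']
  rfl

theorem eLpNorm_rpow_eq {p : ℝ≥0∞} (hp : 1 ≤ p) (hp' : p ≠ ∞) (f : X → ℝ≥0∞) :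
    eLpNorm f p μ ^ p.toReal = ∫⁻ x, f x ^ p.toReal ∂μ := by
  have hp0 : p ≠ 0 := (zero_lt_one.trans_le hp).ne'
  rw [eLpNorm_eq_lintegral_rpow_enorm_toReal hp0 hp', ← ENNReal.rpow_mul,
    one_div_mul_cancel (ENNReal.toReal_pos hp0 hp').ne', ENNReal.rpow_one]
  rfl

/-- For `p = ∞` the norm exceeds `c` exactly when the section of `{F > c}` has positive measure, a
measurable condition on `y`. -/
theorem measurable_eLpNorm_section [SFinite μ] {F : X → Y → ℝ≥0∞}
    (hF : Measurable (Function.uncurry F)) {p : ℝ≥0∞} (hp : 1 ≤ p) :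
    Measurable fun y => eLpNorm (fun x => F x y) p μ := by
  have hp0 : p ≠ 0 := (zero_lt_one.trans_le hp).ne'
  by_cases hp' : p = ∞
  · subst hp'
    refine measurable_of_Ioi fun c => ?_
    have : (fun y => eLpNorm (fun x => F x y) ∞ μ) ⁻¹' Ioi c =
        {y | μ ((fun x => (x, y)) ⁻¹' {z : X × Y | c < F z.1 z.2}) ≠ 0} := by
      ext y
      simp only [mem_preimage, mem_Ioi, eLpNorm_exponent_top, eLpNormEssSup, enorm_eq_self,
        mem_ofPred_eq, ne_eq]
      rw [← not_iff_not, not_lt, not_not]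
      constructor
      · intro h
        have : ∀ᵐ x ∂μ, F x y ≤ essSup (fun x => F x y) μ := ae_le_essSup
        have h2 : ∀ᵐ x ∂μ, F x y ≤ c := by filter_upwards [this] with x hx using hx.trans h
        rw [ae_iff] at h2
        simpa using h2
      · intro h
        refine essSup_le_of_ae_le c ?_
        have : ∀ᵐ x ∂μ, F x y ≤ c := by
          rw [ae_iff]; simpa using h
        exact this
    rw [this]
    exact (measurable_measure_prodMk_right (measurableSet_lt measurable_const hF))
      (measurableSet_singleton 0).compl
  · simp_rw [eLpNorm_eq_lintegral_rpow_enorm_toReal hp0 hp', enorm_eq_self]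
    exact ((hF.pow_const _).lintegral_prod_left).pow_const _

/-- Minkowski's integral inequality. -/
theorem eLpNorm_lintegral_le [SFinite μ] [SFinite ν] {F : X → Y → ℝ≥0∞}
    (hF : Measurable (Function.uncurry F)) {p : ℝ≥0∞} (hp : 1 ≤ p) :
    eLpNorm (fun x => ∫⁻ y, F x y ∂ν) p μ ≤ ∫⁻ y, eLpNorm (fun x => F x y) p μ ∂ν := by
  have hp0 : p ≠ 0 := (zero_lt_one.trans_le hp).ne'
  -- For finite `p` no duality is used: write `F = w · (F/w)`, apply Jensen with density `w`,
  -- exchange the integrals, and use `∫ (F/w)^r dμ ≤ 1`.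
  set w : Y → ℝ≥0∞ := fun y => eLpNorm (fun x => F x y) p μ
  have hw : Measurable w := measurable_eLpNorm_section hF hp
  have hFy : ∀ y, Measurable fun x => F x y := fun y => hF.comp measurable_prodMk_right
  by_cases hp' : p = ∞
  · subst hp'
    have h1 : ∀ᵐ y ∂ν, ∀ᵐ x ∂μ, F x y ≤ w y := Filter.Eventually.of_forall fun y => by
      have := ae_le_eLpNormEssSup (f := fun x => F x y) (μ := μ)
      simpa [w] using this
    have h2 : ∀ᵐ x ∂μ, ∀ᵐ y ∂ν, F x y ≤ w y :=
      (Measure.ae_ae_comm (p := fun y x => F x y ≤ w y)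
        (measurableSet_le (hF.comp measurable_swap) (hw.comp measurable_fst))).1 h1
    rw [eLpNorm_exponent_top]
    refine essSup_le_of_ae_le _ ?_
    filter_upwards [h2] with x hx
    rw [enorm_eq_self]
    exact lintegral_mono_ae hx
  · set r := p.toReal
    have hr : 1 ≤ r := by
      have := ENNReal.toReal_mono hp' hp
      simpa using this
    have hr0 : 0 < r := by linarith
    set W := ∫⁻ y, w y ∂ν
    by_cases hW : W = ∞
    · rw [hW]; exact le_top
    have hwfin : ∀ᵐ y ∂ν, w y < ∞ := ae_lt_top hw hW
    have h1 : ∀ᵐ y ∂ν, ∀ᵐ x ∂μ, F x y = w y * (F x y / w y) := by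
      filter_upwards [hwfin] with y hy
      -- Where `w` vanishes, `F(·,y)` is zero almost everywhere, so `F = w · (F/w)` survives
      -- division by zero.
      by_cases h0 : w y = 0
      · have := (eLpNorm_eq_zero_iff (hFy y).aestronglyMeasurable hp0).1 h0
        filter_upwards [this] with x hx
        simp only [Pi.zero_apply] at hx
        rw [hx, h0]; simp
      · exact Filter.Eventually.of_forall fun x => (ENNReal.mul_div_cancel h0 hy.ne).symm
    have h2 : ∀ᵐ x ∂μ, ∀ᵐ y ∂ν, F x y = w y * (F x y / w y) :=
      (Measure.ae_ae_comm (p := fun y x => F x y = w y * (F x y / w y))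
        (measurableSet_eq_fun (hF.comp measurable_swap) ((hw.comp measurable_fst).mul
          ((hF.comp measurable_swap).div (hw.comp measurable_fst))))).1 h1
    have hFw : Measurable (Function.uncurry fun x y => w y * (F x y / w y) ^ r) :=
      (hw.comp measurable_snd).mul ((hF.div (hw.comp measurable_snd)).pow_const r)
    have hdiv : ∀ x, Measurable fun y => F x y / w y := fun x =>
      (hF.comp measurable_prodMk_left).div hw
    have h3 : eLpNorm (fun x => ∫⁻ y, F x y ∂ν) p μ ^ r ≤ W ^ r := by
      rw [eLpNorm_rpow_eq hp hp']
      calc ∫⁻ x, (∫⁻ y, F x y ∂ν) ^ r ∂μ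
          ≤ ∫⁻ x, W ^ (r - 1) * ∫⁻ y, w y * (F x y / w y) ^ r ∂ν ∂μ := by
            refine lintegral_mono_ae ?_
            filter_upwards [h2] with x hx
            rw [lintegral_congr_ae hx]
            exact rpow_lintegral_mul_le hw.aemeasurable (hdiv x).aemeasurable hr
        _ = W ^ (r - 1) * ∫⁻ y, ∫⁻ x, w y * (F x y / w y) ^ r ∂μ ∂ν := by
            rw [lintegral_const_mul _ hFw.lintegral_prod_right, lintegral_lintegral_swap
              hFw.aemeasurable]
        _ ≤ W ^ (r - 1) * ∫⁻ y, w y ∂ν := by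
            gcongr with y
            rw [lintegral_const_mul _ (((hFy y).div_const _).pow_const r)]
            refine mul_le_of_le_one_right' ?_
            simp_rw [div_eq_mul_inv, ENNReal.mul_rpow_of_nonneg _ _ hr0.le]
            rw [lintegral_mul_const _ ((hFy y).pow_const r), ENNReal.inv_rpow,
              ← eLpNorm_rpow_eq hp hp']
            exact ENNReal.mul_inv_le_one _
        _ = W ^ r := by
            conv_rhs => rw [← sub_add_cancel r 1,
              ENNReal.rpow_add_of_nonneg _ _ (by linarith) zero_le_one, ENNReal.rpow_one]
    exact (ENNReal.rpow_le_rpow_iff hr0).1 h3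

/-- Schur's test in `L^p`, from bounds on the rows and on the weighted columns. -/
theorem eLpNorm_schur_le [SFinite μ] {M : X → X → ℝ≥0∞} {κ : Measure X} [SFinite κ]
    (hM : Measurable (Function.uncurry M)) {A : ℝ≥0∞} (hrow : ∀ x, ∫⁻ y, M x y ∂κ ≤ A)
    (hcol : ∀ φ : X → ℝ≥0∞, Measurable φ →
      ∫⁻ y, (∫⁻ x, M x y ∂μ) * φ y ∂κ ≤ A * ∫⁻ y, φ y ∂μ)
    (hac : κ ≪ μ) {p : ℝ≥0∞} (hp : 1 ≤ p) {φ : X → ℝ≥0∞} (hφ : Measurable φ) :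
    eLpNorm (fun x => ∫⁻ y, M x y * φ y ∂κ) p μ ≤ A * eLpNorm φ p μ := by
  have hMx : ∀ x, Measurable fun y => M x y := fun x => hM.comp measurable_prodMk_left
  by_cases hp' : p = ∞
  · subst hp'
    rw [eLpNorm_exponent_top, eLpNorm_exponent_top]
    have h0 : ∀ᵐ y ∂κ, φ y ≤ eLpNormEssSup φ μ := by
      have : ∀ᵐ y ∂μ, φ y ≤ eLpNormEssSup φ μ := ae_le_eLpNormEssSup
      exact hac.ae_le this
    refine essSup_le_of_ae_le _ (Filter.Eventually.of_forall fun x => ?_)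
    simp only [enorm_eq_self]
    calc ∫⁻ y, M x y * φ y ∂κ ≤ ∫⁻ y, M x y * eLpNormEssSup φ μ ∂κ := by
          refine lintegral_mono_ae ?_
          filter_upwards [h0] with y hy
          gcongr
      _ ≤ A * eLpNormEssSup φ μ := by
          rw [lintegral_mul_const _ (hMx x)]
          gcongr
          exact hrow x
  · set r := p.toReal
    have hr : 1 ≤ r := by
      have := ENNReal.toReal_mono hp' hp
      simpa using this
    have hr0 : 0 < r := by linarith
    have hMφ : Measurable (Function.uncurry fun x y => M x y * φ y ^ r) :=
      hM.mul ((hφ.comp measurable_snd).pow_const r)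
    refine (ENNReal.rpow_le_rpow_iff hr0).1 ?_
    rw [ENNReal.mul_rpow_of_nonneg _ _ hr0.le, eLpNorm_rpow_eq hp hp', eLpNorm_rpow_eq hp hp']
    -- Jensen with density `M x ·` turns the row bound into `A^(r-1)`. The last factor `A` comes
    -- from the column bound, which also passes from `κ`, used for summation, to `μ`, used for the
    -- norm.
    calc ∫⁻ x, (∫⁻ y, M x y * φ y ∂κ) ^ r ∂μ
        ≤ ∫⁻ x, A ^ (r - 1) * ∫⁻ y, M x y * φ y ^ r ∂κ ∂μ := by
          refine lintegral_mono fun x => ?_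
          refine (rpow_lintegral_mul_le (hMx x).aemeasurable hφ.aemeasurable hr).trans ?_
          refine mul_le_mul_left (ENNReal.rpow_le_rpow (hrow x) (by linarith)) _
      _ = A ^ (r - 1) * ∫⁻ y, (∫⁻ x, M x y ∂μ) * φ y ^ r ∂κ := by
          rw [lintegral_const_mul _ hMφ.lintegral_prod_right, lintegral_lintegral_swap
            hMφ.aemeasurable]
          congr 2; ext y
          have hMy : Measurable fun x => M x y := hM.comp measurable_prodMk_right
          rw [lintegral_mul_const _ hMy]
      _ ≤ A ^ (r - 1) * (A * ∫⁻ y, φ y ^ r ∂μ) := by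
          gcongr
          exact hcol _ (hφ.pow_const r)
      _ = A ^ r * ∫⁻ y, φ y ^ r ∂μ := by
          rw [← mul_assoc]
          congr 1
          conv_rhs => rw [← sub_add_cancel r 1,
              ENNReal.rpow_add_of_nonneg _ _ (by linarith) zero_le_one, ENNReal.rpow_one]

end Minkowski

/-- Young's inequality on `ℤ`. -/
theorem eLpNorm_tsum_mul_le (K w : ℤ → ℝ) {p : ℝ≥0∞} (hp : 1 ≤ p) :
    eLpNorm (fun n => ∑' j, K (n - j) * w j) p Measure.count ≤
      (∑' j, ‖K j‖ₑ) * eLpNorm w p Measure.count := by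
  have h1 : ∀ n, ‖∑' j, K (n - j) * w j‖ₑ ≤ ∫⁻ j, ‖K j‖ₑ * ‖w (n - j)‖ₑ ∂Measure.count := by
    intro n
    rw [lintegral_count, ← (Equiv.subLeft n).tsum_eq]
    refine enorm_tsum_le_tsum_enorm.trans (le_of_eq ?_)
    congr 1; ext j
    simp [enorm_mul]
  -- Minkowski over the shift `j`: the convolution is a superposition of translates of `w`, all of
  -- the same norm.
  have h2 := eLpNorm_lintegral_le (μ := (Measure.count : Measure ℤ))
    (ν := (Measure.count : Measure ℤ)) (F := fun n j => ‖K j‖ₑ * ‖w (n - j)‖ₑ)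
    (measurable_of_countable _) hp
  refine (eLpNorm_mono_enorm fun n => (h1 n).trans_eq (enorm_eq_self _).symm).trans (h2.trans ?_)
  rw [lintegral_count, ← ENNReal.tsum_mul_right]
  refine ENNReal.tsum_le_tsum fun j => ?_
  have e : (fun n => ‖K j‖ₑ * ‖w (n - j)‖ₑ) = fun n => ‖K j * w (n - j)‖ₑ := by
    ext n; rw [enorm_mul]
  rw [e, eLpNorm_enorm]
  have h3 : eLpNorm (fun n => w (n - j)) p Measure.count = eLpNorm w p Measure.count := by
    have hm : MeasurePreserving (fun n : ℤ => n - j) Measure.count Measure.count :=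
      measurePreserving_sub_right _ j
    exact eLpNorm_comp_measurePreserving (measurable_of_countable w).aestronglyMeasurable hm
  rw [← h3]
  exact eLpNorm_const_smul_le (c := K j) (f := fun n => w (n - j))

/-- The smoothing estimate `‖Δ e^{tΔ} h‖_p ≤ C t⁻¹ ‖h‖_p`. -/
theorem eLpNorm_lap_heatSemigroup_le {h : ℤ → ℝ} (hh : HeatSummable h) {t : ℝ} (ht : 0 < t)
    {p : ℝ≥0∞} (hp : 1 ≤ p) :
    eLpNorm (lap (heatSemigroup t h)) p Measure.count ≤
      ENNReal.ofReal (128 / t) * eLpNorm h p Measure.count := by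
  have ht2 : 0 < t / 2 := by positivity
  -- Each half of the time absorbs one forward difference, at the cost `‖∇G(t/2)‖₁ ≤ 2 · 4
  -- (t/2)^(-1/2)`. The square of this is `128/t`.
  set D : ℝ≥0∞ := ENNReal.ofReal (8 * (t / 2) ^ (-(1 / 2) : ℝ))
  have hD : ∀ g : ℤ → ℝ, HeatSummable g →
      eLpNorm (fwd (heatSemigroup (t / 2) g)) p Measure.count ≤ D * eLpNorm g p Measure.count := by
    intro g hg
    have e : fwd (heatSemigroup (t / 2) g) = fun n => ∑' j, fwd (heatKernel (t / 2)) (n - j) * g j :=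
      funext fun n => fwd_heatSemigroup hg ht2 n
    rw [e]
    refine (eLpNorm_tsum_mul_le _ _ hp).trans ?_
    gcongr
    obtain ⟨hs, hle⟩ := tsum_abs_heatKernel_sub_le ht2.le
    simp_rw [Real.enorm_eq_ofReal_abs]
    unfold fwd
    rw [← ENNReal.ofReal_tsum_of_nonneg (fun _ => abs_nonneg _) hs]
    refine ENNReal.ofReal_le_ofReal (hle.trans ?_)
    linarith [heatKernel_le_rpow ht2 0]
  have e : lap (heatSemigroup t h) =
      fun n => fwd (heatSemigroup (t / 2) (fwd (heatSemigroup (t / 2) h))) (n - 1) := by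
    ext n
    have e1 : heatSemigroup t h = heatSemigroup (t / 2) (heatSemigroup (t / 2) h) := by
      ext m; rw [heatSemigroup_add hh ht2 ht2, add_halves]
    rw [lap_eq_fwd_fwd, e1, heatSemigroup_fwd (hh.heatSemigroup ht2) ht2]
  have hm : MeasurePreserving (fun n : ℤ => n - 1) Measure.count Measure.count :=
    measurePreserving_sub_right _ 1
  rw [e]
  refine (eLpNorm_comp_measurePreserving
    (g := fwd (heatSemigroup (t / 2) (fwd (heatSemigroup (t / 2) h))))
    (measurable_of_countable _).aestronglyMeasurable hm).trans_le ?_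
  refine (hD _ (hh.heatSemigroup ht2).fwd).trans ?_
  refine (mul_le_mul_right (hD _ hh) D).trans (le_of_eq ?_)
  rw [← mul_assoc, ← ENNReal.ofReal_mul (by positivity)]
  congr 2
  have : (t / 2) ^ (-(1 / 2) : ℝ) * (t / 2) ^ (-(1 / 2) : ℝ) = 2 / t := by
    rw [← Real.rpow_add ht2, show (-(1 / 2) + -(1 / 2) : ℝ) = -1 by norm_num, Real.rpow_neg_one]
    simp
  linear_combination 64 * this

end


/-! ### The fractional integral: kernel bound, convergence, commutation with the semigroup -/

section

theorem lintegral_Ioc_rpow {s b : ℝ} (hs : -1 < s) (hb : 0 < b) :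
    ∫⁻ x in Ioc 0 b, ENNReal.ofReal (x ^ s) = ENNReal.ofReal (b ^ (s + 1) / (s + 1)) := by
  have hi : IntegrableOn (fun x : ℝ => x ^ s) (Ioc 0 b) :=
    (intervalIntegrable_iff_integrableOn_Ioc_of_le hb.le).1 (intervalIntegral.intervalIntegrable_rpow' hs)
  rw [← ofReal_integral_eq_lintegral_ofReal hi
    (ae_restrict_of_forall_mem measurableSet_Ioc fun x hx => Real.rpow_nonneg hx.1.le _),
    ← intervalIntegral.integral_of_le hb.le, integral_rpow (Or.inl hs),
    Real.zero_rpow (by linarith), sub_zero]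

theorem lintegral_Ioi_rpow {s c : ℝ} (hs : s < -1) (hc : 0 < c) :
    ∫⁻ x in Ioi c, ENNReal.ofReal (x ^ s) = ENNReal.ofReal (-c ^ (s + 1) / (s + 1)) := by
  rw [← ofReal_integral_eq_lintegral_ofReal (integrableOn_Ioi_rpow_of_lt hs hc)
    (ae_restrict_of_forall_mem measurableSet_Ioi fun x hx =>
      Real.rpow_nonneg (hc.le.trans (le_of_lt hx)) _), integral_Ioi_rpow_of_lt hs hc]

/-- The weight `(1 + |n|)^(2β-1)`, of the size of the kernel of `(-Δ_d)^(-β)`. -/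
def potentialWeight (β : ℝ) (n : ℤ) : ℝ := (1 + |(n : ℝ)|) ^ (2 * β - 1)

/-- The constant in the bound of the kernel of `(-Δ_d)^(-β)`. -/
def potentialConst (β : ℝ) : ℝ := 1 / β + 4 / (1 / 2 - β)

variable {β : ℝ}

theorem potentialWeight_pos (n : ℤ) : 0 < potentialWeight β n := by
  unfold potentialWeight; positivity

/-- Split at `τ = R²`, `R = 1 + |n|`: use `G ≤ 1/R` below, where `β > 0` gives convergence at `0`,
and `G ≤ 4 τ^(-1/2)` above, where `β < 1/2` gives convergence at infinity. Uniformity in `t ≥ 0` is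
needed for `e^{(t+τ)Δ}`. -/
theorem lintegral_heatKernel_mul_rpow_le (hβ : 0 < β) (hβ' : β < 1 / 2) {t : ℝ} (ht : 0 ≤ t)
    (n : ℤ) : ∫⁻ τ in Ioi 0, ENNReal.ofReal (heatKernel (t + τ) n * τ ^ (β - 1)) ≤
      ENNReal.ofReal (potentialConst β * potentialWeight β n) := by
  set R := 1 + |(n : ℝ)|
  have hR : 0 < R := by positivity
  have hR2 : 0 < R ^ 2 := by positivity
  rw [← Ioc_union_Ioi_eq_Ioi hR2.le, lintegral_union measurableSet_Ioi
    (Set.Ioc_disjoint_Ioi le_rfl)]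
  have h1 : ∫⁻ τ in Ioc 0 (R ^ 2), ENNReal.ofReal (heatKernel (t + τ) n * τ ^ (β - 1)) ≤
      ENNReal.ofReal (1 / β * R ^ (2 * β - 1)) := by
    calc _ ≤ ∫⁻ τ in Ioc 0 (R ^ 2), ENNReal.ofReal R⁻¹ * ENNReal.ofReal (τ ^ (β - 1)) := by
          refine setLIntegral_mono' measurableSet_Ioc fun τ hτ => ?_
          rw [← ENNReal.ofReal_mul (by positivity)]
          refine ENNReal.ofReal_le_ofReal (mul_le_mul_of_nonneg_right ?_ (Real.rpow_nonneg hτ.1.le _))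
          rw [← one_div, le_div_iff₀ hR, mul_comm]
          exact mul_heatKernel_le_one (by linarith [hτ.1]) n
      _ = _ := by
          rw [lintegral_const_mul' _ _ ENNReal.ofReal_ne_top, lintegral_Ioc_rpow (by linarith) hR2,
            ← ENNReal.ofReal_mul (by positivity)]
          congr 1
          rw [← Real.rpow_natCast, ← Real.rpow_mul hR.le, ← Real.rpow_neg_one R,
            show 2 * β - 1 = -1 + (2 : ℕ) * (β - 1 + 1) by push_cast; ring, Real.rpow_add hR]
          rw [sub_add_cancel]; ring
  have h2 : ∫⁻ τ in Ioi (R ^ 2), ENNReal.ofReal (heatKernel (t + τ) n * τ ^ (β - 1)) ≤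
      ENNReal.ofReal (4 / (1 / 2 - β) * R ^ (2 * β - 1)) := by
    calc _ ≤ ∫⁻ τ in Ioi (R ^ 2), ENNReal.ofReal 4 * ENNReal.ofReal (τ ^ (β - 3 / 2)) := by
          refine setLIntegral_mono' measurableSet_Ioi fun τ hτ => ?_
          have hτ0 : 0 < τ := hR2.trans hτ
          rw [← ENNReal.ofReal_mul (by positivity)]
          refine ENNReal.ofReal_le_ofReal ?_
          rw [show β - 3 / 2 = -(1 / 2) + (β - 1) by ring, Real.rpow_add hτ0, ← mul_assoc]
          refine mul_le_mul_of_nonneg_right ?_ (Real.rpow_nonneg hτ0.le _)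
          refine (heatKernel_le_rpow (by linarith) n).trans ?_
          exact mul_le_mul_of_nonneg_left
            (Real.rpow_le_rpow_of_nonpos hτ0 (by linarith) (by norm_num)) (by norm_num)
      _ = _ := by
          rw [lintegral_const_mul' _ _ ENNReal.ofReal_ne_top, lintegral_Ioi_rpow (by linarith) hR2,
            ← ENNReal.ofReal_mul (by positivity)]
          congr 1
          rw [← Real.rpow_natCast, ← Real.rpow_mul hR.le,
            show ((2 : ℕ) : ℝ) * (β - 3 / 2 + 1) = 2 * β - 1 by push_cast; ring]
          have e1 : β - 3 / 2 + 1 = -(1 / 2 - β) := by ring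
          have e2 : (1 / 2 - β) ≠ 0 := by linarith
          rw [e1, neg_div_neg_eq]; ring
  refine (add_le_add h1 h2).trans (le_of_eq ?_)
  have : 0 < 1 / 2 - β := by linarith
  rw [← ENNReal.ofReal_add (by positivity) (by positivity), ← add_mul]
  rfl

theorem one_add_abs_le (n j : ℤ) :
    1 + |(j : ℝ)| ≤ (1 + |(n : ℝ)|) * (1 + |((n - j : ℤ) : ℝ)|) := by
  have : |(j : ℝ)| ≤ |(n : ℝ)| + |((n - j : ℤ) : ℝ)| := by
    have := abs_sub (n : ℝ) ((n - j : ℤ) : ℝ)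
    push_cast at this ⊢
    simpa using this
  nlinarith [abs_nonneg (n : ℝ), abs_nonneg ((n - j : ℤ) : ℝ)]

/-- A Peetre inequality: convergence of the potential series at one point carries over to all
points. -/
theorem potentialWeight_sub_le (hβ' : β < 1 / 2) (n j : ℤ) :
    potentialWeight β (n - j) ≤ (1 + |(n : ℝ)|) ^ (1 - 2 * β) * potentialWeight β j := by
  unfold potentialWeight
  have h := Real.rpow_le_rpow (by positivity) (one_add_abs_le n j) (by linarith : 0 ≤ 1 - 2 * β)
  rw [Real.mul_rpow (by positivity) (by positivity)] at h
  have a1 : 0 < 1 + |(j : ℝ)| := by positivity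
  have a2 : 0 < 1 + |((n - j : ℤ) : ℝ)| := by positivity
  rw [show 2 * β - 1 = -(1 - 2 * β) by ring, Real.rpow_neg a1.le, Real.rpow_neg a2.le,
    ← div_eq_mul_inv, le_div_iff₀ (by positivity), inv_mul_le_iff₀ (by positivity)]
  linarith

variable {f : ℤ → ℝ}

theorem summable_potentialWeight (hf : f ∈ ellSpace (-β)) :
    Summable fun j => potentialWeight β j * |f j| := by
  refine Summable.congr (f := fun m : ℤ => |f m| / (1 + |(m : ℝ)|) ^ (1 + 2 * -β)) hf fun m => ?_
  unfold potentialWeight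
  rw [show 2 * β - 1 = -(1 + 2 * -β) by ring, Real.rpow_neg (by positivity), div_eq_mul_inv, mul_comm]

theorem summable_potentialWeight_sub (hβ' : β < 1 / 2) (hf : f ∈ ellSpace (-β)) (n : ℤ) :
    Summable fun j => potentialWeight β (n - j) * |f j| := by
  refine ((summable_potentialWeight hf).mul_left ((1 + |(n : ℝ)|) ^ (1 - 2 * β))).of_nonneg_of_le
    (fun j => mul_nonneg (potentialWeight_pos _).le (abs_nonneg _)) fun j => ?_
  rw [← mul_assoc]
  exact mul_le_mul_of_nonneg_right (potentialWeight_sub_le hβ' n j) (abs_nonneg _)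

/-- At every time the kernel is at most `(1+|m|)^(-1)`, which is below the weight `(1+|m|)^(2β-1)`.
-/
theorem heatSummable_of_mem_ellSpace (hβ : 0 < β) (hβ' : β < 1 / 2) (hf : f ∈ ellSpace (-β)) :
    HeatSummable f := by
  intro t ht n
  refine (summable_potentialWeight_sub hβ' hf n).of_nonneg_of_le
    (fun j => mul_nonneg (heatKernel_nonneg ht.le _) (abs_nonneg _)) fun j => ?_
  refine mul_le_mul_of_nonneg_right ?_ (abs_nonneg _)
  have h1 := mul_heatKernel_le_one ht.le (n - j)
  have h2 : (1 + |((n - j : ℤ) : ℝ)|) ^ (-1 : ℝ) ≤ potentialWeight β (n - j) :=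
    Real.rpow_le_rpow_of_exponent_le (by linarith [abs_nonneg ((n - j : ℤ) : ℝ)]) (by linarith)
  refine le_trans ?_ h2
  rw [Real.rpow_neg_one, ← one_div, le_div_iff₀ (by positivity), mul_comm]
  exact h1

/-- The bound for `∫ e^{(t+τ)Δ}|f| τ^(β-1) dτ` that is uniform in `t ≥ 0`. -/
theorem lintegral_heatSemigroup_abs_le (hβ : 0 < β) (hβ' : β < 1 / 2) (hf : f ∈ ellSpace (-β))
    {t : ℝ} (ht : 0 ≤ t) (n : ℤ) :
    ∫⁻ τ in Ioi 0, ENNReal.ofReal (heatSemigroup (t + τ) (fun j => |f j|) n * τ ^ (β - 1)) ≤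
      ENNReal.ofReal (potentialConst β * ∑' j, potentialWeight β (n - j) * |f j|) := by
  have hh := heatSummable_of_mem_ellSpace hβ hβ' hf
  have hC : 0 ≤ potentialConst β := by
    have : 0 < 1 / 2 - β := by linarith
    unfold potentialConst; positivity
  calc _ = ∫⁻ τ in Ioi 0, ∑' j, ENNReal.ofReal (heatKernel (t + τ) (n - j) * τ ^ (β - 1)) *
        ENNReal.ofReal |f j| := by
        refine setLIntegral_congr_fun measurableSet_Ioi fun τ hτ => ?_
        have hτ : 0 < τ := hτ
        have htτ : 0 < t + τ := by linarith
        have hp : 0 ≤ τ ^ (β - 1) := Real.rpow_nonneg hτ.le _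
        unfold heatSemigroup
        rw [← tsum_mul_right, ENNReal.ofReal_tsum_of_nonneg]
        · congr 1; ext j
          rw [← ENNReal.ofReal_mul (mul_nonneg (heatKernel_nonneg htτ.le _) hp)]
          congr 1; ring
        · exact fun j => mul_nonneg (mul_nonneg (heatKernel_nonneg htτ.le _) (abs_nonneg _)) hp
        · exact (hh _ htτ n).mul_right _
    _ = ∑' j, (∫⁻ τ in Ioi 0, ENNReal.ofReal (heatKernel (t + τ) (n - j) * τ ^ (β - 1))) *
        ENNReal.ofReal |f j| := by
        rw [lintegral_tsum]
        · congr 1; ext j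
          rw [lintegral_mul_const' _ _ ENNReal.ofReal_ne_top]
        · intro j
          have hc : Continuous fun s => heatKernel s (n - j) :=
            continuous_iff_continuousAt.2 fun s => (hasDerivAt_heatKernel s _).continuousAt
          have : Measurable fun τ : ℝ => heatKernel (t + τ) (n - j) * τ ^ (β - 1) :=
            (hc.measurable.comp (measurable_const_add t)).mul (measurable_id.pow_const _)
          exact (this.ennreal_ofReal.mul_const _).aemeasurable
    _ ≤ ∑' j, ENNReal.ofReal (potentialConst β * (potentialWeight β (n - j) * |f j|)) := by
        refine ENNReal.tsum_le_tsum fun j => ?_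
        rw [← mul_assoc, ENNReal.ofReal_mul (mul_nonneg hC (potentialWeight_pos _).le)]
        gcongr
        exact lintegral_heatKernel_mul_rpow_le hβ hβ' ht (n - j)
    _ = _ := by
        rw [← tsum_mul_left, ENNReal.ofReal_tsum_of_nonneg]
        · exact fun j => mul_nonneg hC (mul_nonneg (potentialWeight_pos _).le (abs_nonneg _))
        · exact (summable_potentialWeight_sub hβ' hf n).mul_left _

theorem continuousOn_heatSemigroup {h : ℤ → ℝ} (hh : HeatSummable h) (n : ℤ) :
    ContinuousOn (fun s => heatSemigroup s h n) (Ioi 0) := fun _ hs =>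
  (hasDerivAt_heatSemigroup hh hs n).continuousAt.continuousWithinAt

theorem aestronglyMeasurable_heatSemigroup {h : ℤ → ℝ} (hh : HeatSummable h) {t : ℝ} (ht : 0 ≤ t)
    (n : ℤ) : AEStronglyMeasurable (fun τ => heatSemigroup (t + τ) h n * τ ^ (β - 1))
      (volume.restrict (Ioi 0)) := by
  have h1 : ContinuousOn (fun τ => heatSemigroup (t + τ) h n) (Ioi 0) :=
    (continuousOn_heatSemigroup hh n).comp (by fun_prop) fun τ hτ => by
      have hτ : 0 < τ := hτ
      exact add_pos_of_nonneg_of_pos ht hτ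
  exact (h1.aestronglyMeasurable measurableSet_Ioi).mul
    (measurable_id.pow_const _).aestronglyMeasurable

theorem enorm_heatSemigroup_mul_le {h : ℤ → ℝ} (hh : HeatSummable h) {s τ : ℝ} (hs : 0 < s)
    (hτ : 0 < τ) (n : ℤ) : ‖heatSemigroup s h n * τ ^ (β - 1)‖ₑ ≤
      ENNReal.ofReal (heatSemigroup s (fun j => |h j|) n * τ ^ (β - 1)) := by
  rw [Real.enorm_eq_ofReal_abs, abs_mul, abs_of_pos (Real.rpow_pos_of_pos hτ _)]
  refine ENNReal.ofReal_le_ofReal (mul_le_mul_of_nonneg_right (abs_heatSemigroup_le hh hs n)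
    (Real.rpow_nonneg hτ.le _))

theorem integrableOn_heatSemigroup (hβ : 0 < β) (hβ' : β < 1 / 2) (hf : f ∈ ellSpace (-β))
    {t : ℝ} (ht : 0 ≤ t) (n : ℤ) :
    IntegrableOn (fun τ => heatSemigroup (t + τ) f n * τ ^ (β - 1)) (Ioi 0) := by
  have hh := heatSummable_of_mem_ellSpace hβ hβ' hf
  refine ⟨aestronglyMeasurable_heatSemigroup hh ht n, ?_⟩
  refine lt_of_le_of_lt ?_ ((lintegral_heatSemigroup_abs_le hβ hβ' hf ht n).trans_lt
    ENNReal.ofReal_lt_top)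
  refine setLIntegral_mono' measurableSet_Ioi fun τ hτ => ?_
  have hτ : 0 < τ := hτ
  exact enorm_heatSemigroup_mul_le hh (by linarith) hτ n

theorem negFracPowerDefined_of_mem_ellSpace (hβ : 0 < β) (hβ' : β < 1 / 2)
    (hf : f ∈ ellSpace (-β)) : NegFracPowerDefined β f := by
  refine fun n => ⟨fun τ hτ => (heatSummable_of_mem_ellSpace hβ hβ' hf).summable hτ n, ?_⟩
  refine (integrableOn_heatSemigroup hβ hβ' hf le_rfl n).congr_fun (fun τ hτ => ?_) measurableSet_Ioi
  have hτ : 0 < τ := hτ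
  simp only [zero_add]
  rw [show β - 1 = -(1 - β) by ring, Real.rpow_neg hτ.le, div_eq_mul_inv]

theorem negFracPower_eq (n : ℤ) : negFracPower β f n =
    1 / Real.Gamma β * ∫ τ in Ioi (0 : ℝ), heatSemigroup τ f n * τ ^ (β - 1) := by
  unfold negFracPower
  congr 1
  refine setIntegral_congr_fun measurableSet_Ioi fun τ hτ => ?_
  have hτ : 0 < τ := hτ
  rw [show β - 1 = -(1 - β) by ring, Real.rpow_neg hτ.le, div_eq_mul_inv]

theorem enorm_negFracPower_le (hβ : 0 < β) (hβ' : β < 1 / 2) (hf : f ∈ ellSpace (-β)) (n : ℤ) :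
    ‖negFracPower β f n‖ₑ ≤ ENNReal.ofReal (1 / Real.Gamma β) *
      ∫⁻ τ in Ioi 0, ENNReal.ofReal (heatSemigroup τ (fun j => |f j|) n * τ ^ (β - 1)) := by
  have hh := heatSummable_of_mem_ellSpace hβ hβ' hf
  have hΓ : 0 < Real.Gamma β := Real.Gamma_pos_of_pos hβ
  rw [negFracPower_eq, enorm_mul, Real.enorm_of_nonneg (by positivity)]
  gcongr
  refine (enorm_integral_le_lintegral_enorm _).trans ?_
  exact setLIntegral_mono' measurableSet_Ioi fun τ hτ => enorm_heatSemigroup_mul_le hh hτ hτ n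

theorem abs_negFracPower_le (hβ : 0 < β) (hβ' : β < 1 / 2) (hf : f ∈ ellSpace (-β)) (n : ℤ) :
    |negFracPower β f n| ≤ potentialConst β / Real.Gamma β *
      ∑' j, potentialWeight β (n - j) * |f j| := by
  have hΓ : 0 < Real.Gamma β := Real.Gamma_pos_of_pos hβ
  have hC : 0 ≤ potentialConst β := by
    have : 0 < 1 / 2 - β := by linarith
    unfold potentialConst; positivity
  have h1 := lintegral_heatSemigroup_abs_le hβ hβ' hf le_rfl n
  simp only [zero_add] at h1
  have h2 := (enorm_negFracPower_le hβ hβ' hf n).trans (mul_le_mul_right h1 _)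
  rw [← ENNReal.ofReal_mul (by positivity), Real.enorm_eq_ofReal_abs] at h2
  have h0 : 0 ≤ ∑' j, potentialWeight β (n - j) * |f j| :=
    tsum_nonneg fun j => mul_nonneg (potentialWeight_pos _).le (abs_nonneg _)
  refine ((ENNReal.ofReal_le_ofReal_iff (by positivity)).1 h2).trans (le_of_eq ?_)
  ring

/-- By Tonelli and the semigroup law this is `∫ e^{(t+τ)Δ}|f|(n) τ^(β-1) dτ`, finite by the bound
uniform in `t`. It gives both the summability of `(-Δ)^(-β)f` and the Fubini step in
`heatSemigroup_negFracPower`. -/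
theorem tsum_lintegral_heatKernel_mul (hβ : 0 < β) (hβ' : β < 1 / 2) (hf : f ∈ ellSpace (-β))
    {t : ℝ} (ht : 0 < t) (n : ℤ) :
    ∑' j, ENNReal.ofReal (heatKernel t (n - j)) *
      ∫⁻ τ in Ioi 0, ENNReal.ofReal (heatSemigroup τ (fun j => |f j|) j * τ ^ (β - 1)) < ∞ := by
  have hh := (heatSummable_of_mem_ellSpace hβ hβ' hf).abs
  refine lt_of_eq_of_lt ?_ ((lintegral_heatSemigroup_abs_le hβ hβ' hf ht.le n).trans_lt
    ENNReal.ofReal_lt_top)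
  simp_rw [← lintegral_const_mul' _ _ ENNReal.ofReal_ne_top]
  rw [← lintegral_tsum]
  · refine setLIntegral_congr_fun measurableSet_Ioi fun τ hτ => ?_
    have hτ : 0 < τ := hτ
    have h0 : ∀ j, 0 ≤ heatSemigroup τ (fun j => |f j|) j := fun j =>
      tsum_nonneg fun i => mul_nonneg (heatKernel_nonneg hτ.le _) (abs_nonneg _)
    have hp : 0 ≤ τ ^ (β - 1) := Real.rpow_nonneg hτ.le _
    rw [← heatSemigroup_add hh ht hτ]
    conv_rhs => rw [heatSemigroup, ← tsum_mul_right]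
    rw [ENNReal.ofReal_tsum_of_nonneg]
    · congr 1; ext j
      rw [← ENNReal.ofReal_mul (heatKernel_nonneg ht.le _), mul_assoc]
    · exact fun j => mul_nonneg (mul_nonneg (heatKernel_nonneg ht.le _) (h0 j)) hp
    · exact ((hh.heatSemigroup hτ).summable ht n).mul_right _
  · intro j
    have := (aestronglyMeasurable_heatSemigroup (β := β) hh le_rfl j).aemeasurable
    simp only [zero_add] at this
    exact this.ennreal_ofReal.const_mul _

theorem heatSummable_negFracPower (hβ : 0 < β) (hβ' : β < 1 / 2) (hf : f ∈ ellSpace (-β)) :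
    HeatSummable (negFracPower β f) := by
  intro t ht n
  have h := tsum_lintegral_heatKernel_mul hβ hβ' hf ht n
  have h2 : ∑' j, ENNReal.ofReal (heatKernel t (n - j) * |negFracPower β f j|) < ∞ := by
    refine lt_of_le_of_lt ?_ (ENNReal.mul_lt_top
      (ENNReal.ofReal_lt_top (r := 1 / Real.Gamma β)) h)
    rw [← ENNReal.tsum_mul_left]
    refine ENNReal.tsum_le_tsum fun j => ?_
    rw [ENNReal.ofReal_mul (heatKernel_nonneg ht.le _), ← Real.enorm_eq_ofReal_abs,
      mul_left_comm]
    gcongr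
    exact enorm_negFracPower_le hβ hβ' hf j
  refine (ENNReal.summable_toReal h2.ne).congr fun j => ?_
  exact ENNReal.toReal_ofReal (mul_nonneg (heatKernel_nonneg ht.le _) (abs_nonneg _))

/-- `e^{tΔ} (-Δ)^(-β) f = Γ(β)⁻¹ ∫ e^{(t+τ)Δ} f τ^(β-1) dτ`. -/
theorem heatSemigroup_negFracPower (hβ : 0 < β) (hβ' : β < 1 / 2) (hf : f ∈ ellSpace (-β))
    {t : ℝ} (ht : 0 < t) (n : ℤ) : heatSemigroup t (negFracPower β f) n =
      1 / Real.Gamma β * ∫ τ in Ioi (0 : ℝ), heatSemigroup (t + τ) f n * τ ^ (β - 1) := by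
  have hh := heatSummable_of_mem_ellSpace hβ hβ' hf
  have e1 : ∫ τ in Ioi (0 : ℝ), heatSemigroup (t + τ) f n * τ ^ (β - 1) =
      ∫ τ in Ioi (0 : ℝ), ∑' j, heatKernel t (n - j) * (heatSemigroup τ f j * τ ^ (β - 1)) := by
    refine setIntegral_congr_fun measurableSet_Ioi fun τ hτ => ?_
    rw [← heatSemigroup_add hh ht hτ]
    conv_lhs => rw [heatSemigroup, ← tsum_mul_right]
    simp_rw [mul_assoc]
  rw [e1, integral_tsum]
  · simp_rw [integral_const_mul]
    rw [← tsum_mul_left]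
    unfold heatSemigroup
    congr 1; ext j
    rw [negFracPower_eq]
    unfold heatSemigroup
    ring
  · intro j
    have := aestronglyMeasurable_heatSemigroup (β := β) hh le_rfl j
    simp only [zero_add] at this
    exact this.const_mul _
  · refine ne_of_lt (lt_of_le_of_lt ?_ (tsum_lintegral_heatKernel_mul hβ hβ' hf ht n))
    refine ENNReal.tsum_le_tsum fun j => ?_
    rw [← lintegral_const_mul' _ _ ENNReal.ofReal_ne_top]
    refine setLIntegral_mono' measurableSet_Ioi fun τ hτ => ?_
    rw [enorm_mul, Real.enorm_of_nonneg (heatKernel_nonneg ht.le _)]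
    gcongr
    exact enorm_heatSemigroup_mul_le hh hτ hτ j

/-- Linearity of the integral suffices because `Δ` is a finite sum; this replaces differentiation
under the integral. Integrability is part of the induction because the next step needs it. -/
theorem integrableOn_and_iterate_lap_integral {U : ℝ → ℤ → ℝ} {μ : Measure ℝ} {φ : ℝ → ℝ}
    (hU : ∀ n, Integrable (fun τ => U τ n * φ τ) μ) (k : ℕ) :
    (∀ n, Integrable (fun τ => (lap^[k] (U τ)) n * φ τ) μ) ∧
    lap^[k] (fun n => ∫ τ, U τ n * φ τ ∂μ) = fun n => ∫ τ, (lap^[k] (U τ)) n * φ τ ∂μ := by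
  induction k with
  | zero => exact ⟨hU, rfl⟩
  | succ k ih =>
    obtain ⟨hi, he⟩ := ih
    have e : ∀ n τ, (lap^[k + 1] (U τ)) n * φ τ = (lap^[k] (U τ)) (n + 1) * φ τ -
        2 * ((lap^[k] (U τ)) n * φ τ) + (lap^[k] (U τ)) (n - 1) * φ τ := by
      intro n τ
      rw [Function.iterate_succ_apply', lap]; ring
    have h2 : ∀ n, Integrable (fun τ => (lap^[k] (U τ)) (n + 1) * φ τ -
        2 * ((lap^[k] (U τ)) n * φ τ)) μ := fun n => (hi (n + 1)).sub ((hi n).const_mul 2)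
    refine ⟨fun n => ?_, ?_⟩
    · simp_rw [e]
      exact (h2 n).add (hi (n - 1))
    · rw [Function.iterate_succ_apply', he]
      ext n
      simp_rw [e]
      rw [integral_add (h2 n) (hi (n - 1)), integral_sub (hi (n + 1)) ((hi n).const_mul 2),
        integral_const_mul]
      rfl

theorem lap_const_mul (c : ℝ) (w : ℤ → ℝ) (k : ℕ) :
    lap^[k] (fun n => c * w n) = fun n => c * (lap^[k] w) n := by
  induction k with
  | zero => rfl
  | succ k ih =>
    rw [Function.iterate_succ_apply', Function.iterate_succ_apply', ih]
    ext n; unfold lap; ring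

theorem iteratedDeriv_heatSemigroup_negFracPower (hβ : 0 < β) (hβ' : β < 1 / 2)
    (hf : f ∈ ellSpace (-β)) (k : ℕ) {t : ℝ} (ht : 0 < t) (n : ℤ) :
    iteratedDeriv k (fun s => heatSemigroup s (negFracPower β f) n) t =
      1 / Real.Gamma β * ∫ τ in Ioi (0 : ℝ), (lap^[k] (heatSemigroup (t + τ) f)) n * τ ^ (β - 1) := by
  rw [iteratedDeriv_heatSemigroup (heatSummable_negFracPower hβ hβ' hf) k ht]
  have e : heatSemigroup t (negFracPower β f) = fun n =>
      1 / Real.Gamma β * ∫ τ in Ioi (0 : ℝ), heatSemigroup (t + τ) f n * τ ^ (β - 1) :=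
    funext fun n => heatSemigroup_negFracPower hβ hβ' hf ht n
  rw [e, lap_const_mul, (integrableOn_and_iterate_lap_integral
    (fun n => integrableOn_heatSemigroup hβ hβ' hf ht.le n) k).2]

end


/-! ### The size condition: Schur's test for the potential on `L^q(μ)` -/

section

theorem lintegral_muZ (F : ℤ → ℝ≥0∞) :
    ∫⁻ n, F n ∂muZ = ∑' n : ℤ, ENNReal.ofReal (1 / (1 + |(n : ℝ)|)) * F n := by
  unfold muZ
  rw [lintegral_sum_measure]
  congr 1; ext n
  rw [lintegral_smul_measure, lintegral_dirac, smul_eq_mul]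

instance : SFinite muZ := by
  unfold muZ; infer_instance

/-- Every point has positive `μ`-mass. Schur's test needs this at the endpoint exponent `∞`. -/
theorem count_absolutelyContinuous_muZ : (Measure.count : Measure ℤ) ≪ muZ := by
  refine Measure.AbsolutelyContinuous.mk fun s hs h0 => ?_
  rw [Measure.count_eq_zero_iff]
  by_contra hne
  obtain ⟨n, hn⟩ := Set.nonempty_iff_ne_empty.2 hne
  have h1 : muZ {n} = 0 := measure_mono_null (Set.singleton_subset_iff.2 hn) h0
  rw [← lintegral_indicator_one (measurableSet_singleton n), lintegral_muZ,
    ENNReal.tsum_eq_zero] at h1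
  have := h1 n
  simp only [mem_singleton_iff, indicator_of_mem, Pi.one_apply, mul_one,
    ENNReal.ofReal_eq_zero] at this
  have h2 : 0 < 1 / (1 + |(n : ℝ)|) := by positivity
  linarith

theorem tsum_natAbs_le (F : ℕ → ℝ≥0∞) : ∑' m : ℤ, F m.natAbs ≤ 2 * ∑' N, F N := by
  have h1 : HasSum (fun N : ℕ => F (N : ℤ).natAbs) (∑' N, F N) := by
    simpa using ENNReal.summable.hasSum
  have h2 : HasSum (fun N : ℕ => F (-((N : ℤ) + 1)).natAbs) (∑' N, F (N + 1)) := by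
    have e : ∀ N : ℕ, (-((N : ℤ) + 1)).natAbs = N + 1 := fun N => by omega
    simp_rw [e]
    exact ENNReal.summable.hasSum
  rw [(HasSum.of_nat_of_neg_add_one (f := fun m : ℤ => F m.natAbs) h1 h2).tsum_eq, two_mul]
  exact add_le_add le_rfl (ENNReal.tsum_comp_le_tsum_of_injective (add_left_injective 1) F)

/-- A discrete integral comparison: `b` plays the role of a bounded primitive of `c`. -/
theorem tsum_ofReal_le_of_telescope {c b : ℕ → ℝ} {X : ℝ} (hc : ∀ N, 0 ≤ c N)
    (hcb : ∀ N, c N ≤ b (N + 1) - b N) (hb0 : 0 ≤ b 0) (hbX : ∀ N, b N ≤ X) :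
    ∑' N, ENNReal.ofReal (c N) ≤ ENNReal.ofReal X := by
  refine ENNReal.tsum_le_of_sum_range_le fun K => ?_
  rw [← ENNReal.ofReal_sum_of_nonneg fun N _ => hc N]
  refine ENNReal.ofReal_le_ofReal ((Finset.sum_le_sum fun N _ => hcb N).trans ?_)
  rw [Finset.sum_range_sub]
  linarith [hbX K]

/-- The weight `1 + |n|`. -/
def japanese (n : ℤ) : ℝ := 1 + |(n : ℝ)|

theorem one_le_japanese (n : ℤ) : 1 ≤ japanese n := by
  unfold japanese; linarith [abs_nonneg (n : ℝ)]

theorem japanese_pos (n : ℤ) : 0 < japanese n := zero_lt_one.trans_le (one_le_japanese n)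

theorem japanese_eq_natAbs (n : ℤ) : japanese n = (n.natAbs : ℝ) + 1 := by
  rw [japanese, Nat.cast_natAbs, Int.cast_abs, add_comm]

theorem japanese_sub_le (n j : ℤ) : japanese (n - j) ≤ japanese n + japanese j := by
  unfold japanese
  push_cast
  linarith [abs_sub (n : ℝ) (j : ℝ)]

theorem japanese_le_sub_add (n j : ℤ) : japanese j ≤ japanese (n - j) + japanese n := by
  have := japanese_sub_le n (n - j)
  rw [sub_sub_cancel] at this
  linarith

theorem japanese_sub_comm (n j : ℤ) : japanese (n - j) = japanese (j - n) := by
  unfold japanese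
  push_cast
  rw [abs_sub_comm]

theorem potentialWeight_eq (β : ℝ) (n : ℤ) : potentialWeight β n = japanese n ^ (2 * β - 1) := rfl

theorem tsum_japanese_rpow_le {s : ℝ} (hs : 0 < s) (hs1 : s ≤ 1) {X : ℝ} (hX : 0 ≤ X) :
    ∑' m : ℤ, (if japanese m ≤ X then ENNReal.ofReal (japanese m ^ (s - 1)) else 0) ≤
      ENNReal.ofReal (2 * (X ^ s / s)) := by
  set c : ℕ → ℝ := fun N => if (N : ℝ) + 1 ≤ X then ((N : ℝ) + 1) ^ (s - 1) else 0
  have e : ∀ m : ℤ, (if japanese m ≤ X then ENNReal.ofReal (japanese m ^ (s - 1)) else 0) =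
      ENNReal.ofReal (c m.natAbs) := by
    intro m
    rw [japanese_eq_natAbs]
    simp only [c]
    split_ifs <;> simp
  simp_rw [e]
  refine (tsum_natAbs_le fun N => ENNReal.ofReal (c N)).trans ?_
  rw [ENNReal.ofReal_mul zero_le_two, ENNReal.ofReal_ofNat]
  gcongr
  -- The primitive of `x^(s-1)`, frozen at `X`. Bernoulli's inequality for exponent `s ≤ 1` gives `s
  -- (N+1)^(s-1) ≤ (N+1)^s - N^s`.
  refine tsum_ofReal_le_of_telescope (b := fun N => min X N ^ s / s) (fun N => ?_) (fun N => ?_)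
    (by positivity) (fun N => ?_)
  · simp only [c]; split_ifs <;> positivity
  · simp only [c]
    split_ifs with h
    · have hN : (N : ℝ) ≤ X := by linarith
      have hp : (0 : ℝ) < (N : ℝ) + 1 := by positivity
      push_cast
      rw [min_eq_right h, min_eq_right hN, ← sub_div, le_div_iff₀ hs]
      have hB := rpow_one_add_le_one_add_mul_self (s := -1 / ((N : ℝ) + 1))
        (by rw [le_div_iff₀ hp]; linarith [Nat.cast_nonneg (α := ℝ) N]) hs.le hs1
      have e1 : 1 + -1 / ((N : ℝ) + 1) = N / ((N : ℝ) + 1) := by field_simp; ring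
      rw [e1, Real.div_rpow (by positivity) hp.le, div_le_iff₀ (by positivity)] at hB
      rw [Real.rpow_sub_one hp.ne']
      have e2 : (1 + s * (-1 / ((N : ℝ) + 1))) * ((N : ℝ) + 1) ^ s =
        ((N : ℝ) + 1) ^ s - ((N : ℝ) + 1) ^ s / ((N : ℝ) + 1) * s := by ring
      linarith
    · rw [sub_nonneg]
      push_cast
      gcongr
      linarith
  · gcongr
    exact min_le_left _ _

theorem tsum_japanese_inv_sq_le {X : ℝ} (hX : 0 < X) :
    ∑' m : ℤ, (if X < japanese m then ENNReal.ofReal (japanese m ^ (-2 : ℝ)) else 0) ≤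
      ENNReal.ofReal (2 * (2 / X)) := by
  set c : ℕ → ℝ := fun N => if X < (N : ℝ) + 1 then ((N : ℝ) + 1) ^ (-2 : ℝ) else 0
  have e : ∀ m : ℤ, (if X < japanese m then ENNReal.ofReal (japanese m ^ (-2 : ℝ)) else 0) =
      ENNReal.ofReal (c m.natAbs) := by
    intro m
    rw [japanese_eq_natAbs]
    simp only [c]
    split_ifs <;> simp
  simp_rw [e]
  refine (tsum_natAbs_le fun N => ENNReal.ofReal (c N)).trans ?_
  rw [ENNReal.ofReal_mul zero_le_two, ENNReal.ofReal_ofNat]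
  gcongr
  -- The primitive `-2/x` of `2/x²`, frozen below `X`; the factor `2` pays for `1/M² ≤ 2/(M(M+1))`.
  refine tsum_ofReal_le_of_telescope (b := fun N => 2 / X - 2 / max X ((N : ℝ) + 1)) (fun N => ?_)
    (fun N => ?_) ?_ (fun N => ?_)
  · simp only [c]; split_ifs <;> positivity
  · simp only [c]
    split_ifs with h
    · have h2 : X ≤ (N : ℝ) + 1 + 1 := by linarith
      push_cast
      rw [max_eq_right h.le, max_eq_right h2]
      have hp : (0 : ℝ) < (N : ℝ) + 1 := by positivity
      rw [Real.rpow_neg hp.le, show ((N : ℝ) + 1) ^ (2 : ℝ) = ((N : ℝ) + 1) ^ 2 by norm_cast]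
      have e3 : 2 / X - 2 / ((N : ℝ) + 1 + 1) - (2 / X - 2 / ((N : ℝ) + 1)) =
        2 / (((N : ℝ) + 1) * ((N : ℝ) + 1 + 1)) := by field_simp; ring
      rw [e3, inv_eq_one_div, div_le_div_iff₀ (by positivity) (by positivity)]
      nlinarith [Nat.cast_nonneg (α := ℝ) N]
    · rw [sub_nonneg]
      have hm : 0 < max X ((N : ℝ) + 1) := hX.trans_le (le_max_left _ _)
      have : max X ((N : ℝ) + 1) ≤ max X (((N + 1 : ℕ) : ℝ) + 1) := by
        apply max_le_max le_rfl
        push_cast; linarith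
      gcongr
  · have hm : X ≤ max X (((0 : ℕ) : ℝ) + 1) := le_max_left _ _
    rw [sub_nonneg]
    gcongr
  · have hm : 0 < max X ((N : ℝ) + 1) := hX.trans_le (le_max_left _ _)
    have : 0 ≤ 2 / max X ((N : ℝ) + 1) := by positivity
    linarith

theorem japanese_rpow_le {a : ℝ} (ha : 0 ≤ a) (n : ℤ) :
    japanese n ^ a ≤ 2 ^ a * (1 + |(n : ℝ)| ^ a) := by
  have h1 : japanese n ≤ 2 * max 1 |(n : ℝ)| := by
    unfold japanese
    linarith [le_max_left 1 |(n : ℝ)|, le_max_right 1 |(n : ℝ)|]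
  refine (Real.rpow_le_rpow (japanese_pos n).le h1 ha).trans ?_
  rw [Real.mul_rpow zero_le_two (by positivity)]
  gcongr
  rcases max_cases 1 |(n : ℝ)| with ⟨h, _⟩ | ⟨h, _⟩ <;> rw [h]
  · rw [Real.one_rpow]; linarith [Real.rpow_nonneg (abs_nonneg (n : ℝ)) a]
  · linarith

theorem one_add_rpow_le {a : ℝ} (ha : 0 ≤ a) (n : ℤ) :
    1 + |(n : ℝ)| ^ a ≤ 2 * japanese n ^ a := by
  have h1 : 1 ≤ japanese n ^ a := Real.one_le_rpow (one_le_japanese n) ha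
  have h2 : |(n : ℝ)| ^ a ≤ japanese n ^ a :=
    Real.rpow_le_rpow (abs_nonneg _) (by unfold japanese; linarith) ha
  linarith

/-- The function is at most `1`, so for finite `q` its `q`-th power is no larger than itself, and `∑
⟨n⟩^(-1-γ)` converges. -/
theorem memLp_japanese_rpow {γ : ℝ} (hγ : 0 < γ) {q : ℝ≥0∞} (hq : 1 ≤ q) :
    MemLp (fun n => japanese n ^ (-γ)) q muZ := by
  have h1 : ∀ n, japanese n ^ (-γ) ≤ 1 := fun n =>
    Real.rpow_le_one_of_one_le_of_nonpos (one_le_japanese n) (by linarith)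
  have h0 : ∀ n, 0 ≤ japanese n ^ (-γ) := fun n => Real.rpow_nonneg (japanese_pos n).le _
  have hm : AEStronglyMeasurable (fun n => japanese n ^ (-γ)) muZ :=
    (measurable_of_countable _).aestronglyMeasurable
  by_cases hq' : q = ∞
  · subst hq'
    refine memLp_top_of_bound hm 1 (Filter.Eventually.of_forall fun n => ?_)
    rw [Real.norm_of_nonneg (h0 n)]
    exact h1 n
  · have hr : 1 ≤ q.toReal := by simpa using ENNReal.toReal_mono hq' hq
    refine ⟨hm, ?_⟩
    rw [← eLpNorm_enorm]
    refine (ENNReal.rpow_lt_top_iff_of_pos (lt_of_lt_of_le one_pos hr)).1 ?_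
    rw [eLpNorm_rpow_eq hq hq', lintegral_muZ]
    have hs : Summable fun n : ℤ => japanese n ^ (-(1 + γ)) := by
      have hN : Summable fun N : ℕ => ((N : ℝ) + 1) ^ (-(1 + γ)) := by
        have := (summable_nat_add_iff 1).2 (Real.summable_nat_rpow.2 (by linarith : -(1 + γ) < -1))
        simpa using this
      refine Summable.of_nat_of_neg ?_ ?_ <;>
      · refine hN.congr fun N => ?_
        rw [japanese_eq_natAbs]; simp
    refine lt_of_le_of_lt ?_ (hs.tsum_ofReal_lt_top)
    refine ENNReal.tsum_le_tsum fun n => ?_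
    rw [Real.enorm_of_nonneg (h0 n), ENNReal.ofReal_rpow_of_nonneg (h0 n) (by linarith),
      ← ENNReal.ofReal_mul (by positivity)]
    refine ENNReal.ofReal_le_ofReal ?_
    rw [show -(1 + γ) = -1 + -γ by ring, Real.rpow_add (japanese_pos n), Real.rpow_neg_one, one_div]
    have : (japanese n ^ (-γ)) ^ q.toReal ≤ (japanese n ^ (-γ)) ^ (1 : ℝ) :=
      Real.rpow_le_rpow_of_exponent_ge' (h0 n) (h1 n) zero_le_one hr
    rw [Real.rpow_one] at this
    exact mul_le_mul_of_nonneg_left this (inv_nonneg.2 (japanese_pos n).le)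

variable {β : ℝ}

/-- The part near the diagonal of the kernel of `(-Δ_d)^(-β)`, normalized by `(1+|n|)^(-2β)`. -/
def nearKernel (β : ℝ) (n j : ℤ) : ℝ≥0∞ :=
  if japanese j ≤ 2 * japanese n then
    ENNReal.ofReal (japanese n ^ (-(2 * β)) * potentialWeight β (n - j)) else 0

/-- With `m = n - j`, the near region lies in `⟨m⟩ ≤ 3⟨n⟩`. -/
theorem tsum_potentialWeight_sub_le (hβ : 0 < β) (hβ' : β < 1 / 2) (n : ℤ) :
    ∑' j, (if japanese j ≤ 2 * japanese n then ENNReal.ofReal (potentialWeight β (n - j)) else 0) ≤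
      ENNReal.ofReal (2 * ((3 * japanese n) ^ (2 * β) / (2 * β))) := by
  refine le_trans ?_ (tsum_japanese_rpow_le (by linarith : 0 < 2 * β) (by linarith)
    (by linarith [japanese_pos n] : 0 ≤ 3 * japanese n))
  rw [← (Equiv.subLeft n).tsum_eq (fun m : ℤ =>
    if japanese m ≤ 3 * japanese n then ENNReal.ofReal (japanese m ^ (2 * β - 1)) else 0)]
  refine ENNReal.tsum_le_tsum fun j => ?_
  simp only [Equiv.subLeft_apply]
  split_ifs with h1 h2
  · exact le_rfl
  · exact absurd (by linarith [japanese_sub_le n j]) h2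
  · exact bot_le
  · exact le_rfl

/-- The common bound of the row and column sums of `nearKernel`. -/
def nearConst (β : ℝ) : ℝ := 2 ^ (1 + 2 * β) * (2 * (3 ^ (2 * β) / (2 * β))) + 8

theorem tsum_nearKernel_le (hβ : 0 < β) (hβ' : β < 1 / 2) (n : ℤ) :
    ∑' j, nearKernel β n j ≤ ENNReal.ofReal (nearConst β) := by
  have hJ := japanese_pos n
  have e : ∀ j, nearKernel β n j = ENNReal.ofReal (japanese n ^ (-(2 * β))) *
      (if japanese j ≤ 2 * japanese n then ENNReal.ofReal (potentialWeight β (n - j)) else 0) := by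
    intro j
    unfold nearKernel
    rw [ENNReal.ofReal_mul (by positivity)]
    split_ifs <;> simp
  simp_rw [e]
  rw [ENNReal.tsum_mul_left]
  refine (mul_le_mul_right (tsum_potentialWeight_sub_le hβ hβ' n) _).trans ?_
  rw [← ENNReal.ofReal_mul (by positivity)]
  refine ENNReal.ofReal_le_ofReal ?_
  have e1 : japanese n ^ (-(2 * β)) * (2 * ((3 * japanese n) ^ (2 * β) / (2 * β))) =
      2 * (3 ^ (2 * β) / (2 * β)) := by
    rw [Real.mul_rpow (by norm_num) hJ.le, Real.rpow_neg hJ.le]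
    have : japanese n ^ (2 * β) ≠ 0 := by positivity
    field_simp
  rw [e1]
  unfold nearConst
  have h1 : (1 : ℝ) ≤ 2 ^ (1 + 2 * β) := Real.one_le_rpow (by norm_num) (by linarith)
  have h2 : 0 ≤ 2 * ((3 : ℝ) ^ (2 * β) / (2 * β)) := by positivity
  nlinarith

/-- In the far region `⟨n-j⟩ ≥ ⟨j⟩/2`, and the constant is `2^(1-2β) ≤ 2`. -/
theorem potentialWeight_far_le (hβ : 0 < β) (hβ' : β < 1 / 2) {n j : ℤ}
    (h : 2 * japanese n < japanese j) :
    potentialWeight β (n - j) ≤ 2 * japanese j ^ (2 * β - 1) := by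
  have h1 : japanese j / 2 ≤ japanese (n - j) := by linarith [japanese_le_sub_add n j]
  have hj := japanese_pos j
  rw [potentialWeight_eq]
  refine (Real.rpow_le_rpow_of_nonpos (by positivity) h1 (by linarith)).trans ?_
  rw [Real.div_rpow hj.le zero_le_two, div_eq_mul_inv, mul_comm]
  gcongr
  rw [← Real.rpow_neg zero_le_two]
  calc (2 : ℝ) ^ (-(2 * β - 1)) ≤ 2 ^ (1 : ℝ) :=
        Real.rpow_le_rpow_of_exponent_le (by norm_num) (by linarith)
    _ = 2 := Real.rpow_one 2

/-- Split at `⟨n⟩ = 2⟨j⟩`. Below, `⟨n⟩ ≥ ⟨j⟩/2` on the support of the kernel, so `⟨n⟩^(-1-2β)` is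
replaced by a multiple of `⟨j⟩^(-1-2β)` and the row estimate applies. Above, the summand is at most
`2⟨n⟩^(-2)`, with tail of order `1/⟨j⟩`. -/
theorem tsum_mul_nearKernel_le (hβ : 0 < β) (hβ' : β < 1 / 2) (j : ℤ) :
    ∑' n : ℤ, ENNReal.ofReal (1 / (1 + |(n : ℝ)|)) * nearKernel β n j ≤
      ENNReal.ofReal (nearConst β) * ENNReal.ofReal (1 / (1 + |(j : ℝ)|)) := by
  have hj := japanese_pos j
  have hterm : ∀ n : ℤ, ENNReal.ofReal (1 / (1 + |(n : ℝ)|)) * nearKernel β n j ≤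
      ENNReal.ofReal (2 ^ (1 + 2 * β) * japanese j ^ (-(1 + 2 * β))) *
        (if japanese n ≤ 2 * japanese j then ENNReal.ofReal (potentialWeight β (j - n)) else 0) +
      ENNReal.ofReal 2 *
        (if 2 * japanese j < japanese n then ENNReal.ofReal (japanese n ^ (-2 : ℝ)) else 0) := by
    intro n
    have hn := japanese_pos n
    unfold nearKernel
    split_ifs with h1 h2 h3 h3
    · linarith
    · rw [mul_zero, add_zero, ← ENNReal.ofReal_mul (by positivity), ← ENNReal.ofReal_mul (by positivity)]
      refine ENNReal.ofReal_le_ofReal ?_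
      have e1 : 1 / (1 + |(n : ℝ)|) * (japanese n ^ (-(2 * β)) * potentialWeight β (n - j)) =
          japanese n ^ (-(1 + 2 * β)) * potentialWeight β (j - n) := by
        rw [neg_add, Real.rpow_add hn, Real.rpow_neg_one, potentialWeight_eq, potentialWeight_eq,
          japanese_sub_comm, one_div]
        unfold japanese; ring
      rw [e1]
      refine mul_le_mul_of_nonneg_right ?_ (potentialWeight_pos _).le
      have h4 : japanese j / 2 ≤ japanese n := by linarith
      refine (Real.rpow_le_rpow_of_nonpos (by positivity) h4 (by linarith)).trans (le_of_eq ?_)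
      rw [Real.div_rpow hj.le zero_le_two, Real.rpow_neg zero_le_two]
      field_simp
    · rw [mul_zero, zero_add, ← ENNReal.ofReal_mul (by positivity), ← ENNReal.ofReal_mul (by positivity)]
      refine ENNReal.ofReal_le_ofReal ?_
      have h5 := potentialWeight_far_le hβ hβ' h3
      have e2 : potentialWeight β (n - j) = potentialWeight β (j - n) := by
        rw [potentialWeight_eq, potentialWeight_eq, japanese_sub_comm]
      rw [e2]
      have e3 : (2 : ℝ) * japanese n ^ (-2 : ℝ) = 1 / (1 + |(n : ℝ)|) * (japanese n ^ (-(2 * β)) *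
          (2 * japanese n ^ (2 * β - 1))) := by
        have : japanese n ^ (-2 : ℝ) = (japanese n)⁻¹ * (japanese n ^ (-(2 * β)) *
            japanese n ^ (2 * β - 1)) := by
          rw [← Real.rpow_add hn, ← Real.rpow_neg_one, ← Real.rpow_add hn]
          congr 1; ring
        rw [this, one_div]
        unfold japanese; ring
      rw [e3]
      gcongr
    · linarith
    · simp
    · simp
    · simp
    · simp
  refine (ENNReal.tsum_le_tsum hterm).trans ?_
  rw [ENNReal.tsum_add, ENNReal.tsum_mul_left, ENNReal.tsum_mul_left]
  refine (add_le_add (mul_le_mul_right (tsum_potentialWeight_sub_le hβ hβ' j) _)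
    (mul_le_mul_right (tsum_japanese_inv_sq_le (X := 2 * japanese j) (by positivity)) _)).trans ?_
  have hc : 0 ≤ nearConst β := by unfold nearConst; positivity
  rw [← ENNReal.ofReal_mul (by positivity), ← ENNReal.ofReal_mul (by positivity),
    ← ENNReal.ofReal_add (by positivity) (by positivity), ← ENNReal.ofReal_mul hc]
  refine ENNReal.ofReal_le_ofReal ?_
  have e4 : 2 ^ (1 + 2 * β) * japanese j ^ (-(1 + 2 * β)) *
      (2 * ((3 * japanese j) ^ (2 * β) / (2 * β))) =
      2 ^ (1 + 2 * β) * (2 * (3 ^ (2 * β) / (2 * β))) * (japanese j)⁻¹ := by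
    rw [Real.mul_rpow (by norm_num) hj.le, neg_add, Real.rpow_add hj, Real.rpow_neg_one,
      Real.rpow_neg hj.le]
    have : japanese j ^ (2 * β) ≠ 0 := by positivity
    field_simp
  rw [e4, show 1 / (1 + |(j : ℝ)|) = (japanese j)⁻¹ from one_div _]
  unfold nearConst
  -- The tail contributes `4/⟨j⟩`, within the summand `8` of `nearConst`.
  have e5 : 2 * (2 * (2 / (2 * japanese j))) = 4 * (japanese j)⁻¹ := by field_simp; norm_num
  rw [e5, add_mul]
  have : 0 ≤ (japanese j)⁻¹ := by positivity
  linarith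

variable {f : ℤ → ℝ} {α : ℝ}

/-- Pointwise bound of the normalized potential by a bounded part and a Schur operator. -/
theorem enorm_negFracPower_div_le (hα : 0 < α) (hβ : 0 < β) (hβ' : β < 1 / 2)
    (hf : f ∈ ellSpace (-β)) : ∃ c₁ c₂ : ℝ, 0 ≤ c₂ ∧ ∀ n : ℤ,
    ‖negFracPower β f n / (1 + |(n : ℝ)| ^ (α + 2 * β))‖ₑ ≤
      ‖c₁ * japanese n ^ (-(α + 2 * β))‖ₑ + ENNReal.ofReal c₂ *
        ∑' j, nearKernel β n j * ‖f j / (1 + |(j : ℝ)| ^ α)‖ₑ := by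
  set γ := α + 2 * β
  have hγ : 0 < γ := by positivity
  have hΓ : 0 < Real.Gamma β := Real.Gamma_pos_of_pos hβ
  set C := potentialConst β / Real.Gamma β * 2 ^ γ
  have hC : 0 ≤ C := by
    have : 0 < 1 / 2 - β := by linarith
    simp only [C]; unfold potentialConst; positivity
  set S := ∑' j, potentialWeight β j * |f j|
  have hS : 0 ≤ S := tsum_nonneg fun j => mul_nonneg (potentialWeight_pos _).le (abs_nonneg _)
  -- Far from the diagonal `potentialWeight_far_le` bounds the sum by `2S`, whence `c₁`. Near it, `1
  -- + |j|^α ≤ 2 · 2^α ⟨n⟩^α` turns `f` into its normalization, whence `c₂`.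
  refine ⟨2 * C * S, C * (2 * 2 ^ α), by positivity, fun n => ?_⟩
  have hn := japanese_pos n
  have hnγ : 0 < japanese n ^ (-γ) := by positivity
  have h1 : ‖negFracPower β f n / (1 + |(n : ℝ)| ^ γ)‖ₑ ≤
      ∑' j, ENNReal.ofReal (C * japanese n ^ (-γ) * (potentialWeight β (n - j) * |f j|)) := by
    rw [← ENNReal.ofReal_tsum_of_nonneg
      (fun j => mul_nonneg (by positivity) (mul_nonneg (potentialWeight_pos _).le (abs_nonneg _)))
      ((summable_potentialWeight_sub hβ' hf n).mul_left _), tsum_mul_left,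
      Real.enorm_eq_ofReal_abs, abs_div]
    refine ENNReal.ofReal_le_ofReal ?_
    have hd : 0 < 1 + |(n : ℝ)| ^ γ := by positivity
    rw [abs_of_pos hd, div_le_iff₀ hd]
    have h2 := abs_negFracPower_le hβ hβ' hf n
    have h3 : 1 ≤ 2 ^ γ * japanese n ^ (-γ) * (1 + |(n : ℝ)| ^ γ) := by
      rw [Real.rpow_neg hn.le]
      have := japanese_rpow_le hγ.le n
      rw [mul_right_comm, ← div_eq_mul_inv, le_div_iff₀ (by positivity), one_mul]
      exact this
    have h4 : 0 ≤ |negFracPower β f n| := abs_nonneg _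
    calc _ ≤ _ := h2
      _ ≤ (potentialConst β / Real.Gamma β * ∑' j, potentialWeight β (n - j) * |f j|) *
          (2 ^ γ * japanese n ^ (-γ) * (1 + |(n : ℝ)| ^ γ)) :=
          le_mul_of_one_le_right (h4.trans h2) h3
      _ = _ := by simp only [C]; ring
  refine h1.trans ?_
  have hterm : ∀ j, ENNReal.ofReal (C * japanese n ^ (-γ) * (potentialWeight β (n - j) * |f j|)) ≤
      ENNReal.ofReal (2 * C * japanese n ^ (-γ)) * ENNReal.ofReal (potentialWeight β j * |f j|) +
      ENNReal.ofReal (C * (2 * 2 ^ α)) * (nearKernel β n j * ‖f j / (1 + |(j : ℝ)| ^ α)‖ₑ) := by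
    intro j
    have hj := japanese_pos j
    by_cases h : japanese j ≤ 2 * japanese n
    · refine le_trans ?_ le_add_self
      unfold nearKernel
      rw [if_pos h, Real.enorm_eq_ofReal_abs, ← ENNReal.ofReal_mul
        (mul_nonneg (by positivity) (potentialWeight_pos _).le), ← ENNReal.ofReal_mul (by positivity)]
      refine ENNReal.ofReal_le_ofReal ?_
      have hd : 0 < 1 + |(j : ℝ)| ^ α := by positivity
      have h5 : 1 + |(j : ℝ)| ^ α ≤ 2 * 2 ^ α * japanese n ^ α := by
        refine (one_add_rpow_le hα.le j).trans ?_
        rw [mul_assoc, ← Real.mul_rpow zero_le_two hn.le]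
        gcongr
      have h6 : |f j| ≤ 2 * 2 ^ α * japanese n ^ α * |f j / (1 + |(j : ℝ)| ^ α)| := by
        rw [abs_div, abs_of_pos hd, mul_div_assoc', le_div_iff₀ hd, mul_comm]
        exact mul_le_mul_of_nonneg_right h5 (abs_nonneg _)
      have e1 : japanese n ^ (-γ) * japanese n ^ α = japanese n ^ (-(2 * β)) := by
        rw [← Real.rpow_add hn]
        congr 1; simp only [γ]; ring
      calc _ ≤ C * japanese n ^ (-γ) * (potentialWeight β (n - j) *
            (2 * 2 ^ α * japanese n ^ α * |f j / (1 + |(j : ℝ)| ^ α)|)) := by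
            refine mul_le_mul_of_nonneg_left ?_ (by positivity)
            exact mul_le_mul_of_nonneg_left h6 (potentialWeight_pos _).le
        _ = _ := by rw [← e1]; ring
    · refine le_trans ?_ le_self_add
      rw [← ENNReal.ofReal_mul (by positivity)]
      refine ENNReal.ofReal_le_ofReal ?_
      have h7 := potentialWeight_far_le hβ hβ' (not_le.1 h)
      rw [← potentialWeight_eq] at h7
      calc _ ≤ C * japanese n ^ (-γ) * (2 * potentialWeight β j * |f j|) := by gcongr
        _ = _ := by ring
  refine (ENNReal.tsum_le_tsum hterm).trans ?_
  rw [ENNReal.tsum_add, ENNReal.tsum_mul_left, ENNReal.tsum_mul_left]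
  gcongr
  rw [← ENNReal.ofReal_tsum_of_nonneg (fun j => mul_nonneg (potentialWeight_pos _).le (abs_nonneg _))
    (summable_potentialWeight hf), ← ENNReal.ofReal_mul (by positivity),
    Real.enorm_of_nonneg (by positivity)]
  refine ENNReal.ofReal_le_ofReal (le_of_eq ?_)
  simp only [S]; ring

theorem memLp_negFracPower (hα : 0 < α) (hβ : 0 < β) (hβ' : β < 1 / 2)
    (hf : f ∈ ellSpace (-β)) {q : ℝ≥0∞} (hq : 1 ≤ q)
    (hfq : MemLp (fun n : ℤ => f n / (1 + |(n : ℝ)| ^ α)) q muZ) :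
    MemLp (fun n : ℤ => negFracPower β f n / (1 + |(n : ℝ)| ^ (α + 2 * β))) q muZ := by
  refine ⟨(measurable_of_countable _).aestronglyMeasurable, ?_⟩
  obtain ⟨c₁, c₂, hc₂, hle⟩ := enorm_negFracPower_div_le hα hβ hβ' hf
  set φ : ℤ → ℝ≥0∞ := fun j => ‖f j / (1 + |(j : ℝ)| ^ α)‖ₑ
  have hschur := eLpNorm_schur_le (μ := muZ) (κ := Measure.count) (M := nearKernel β)
    (measurable_of_countable _) (A := ENNReal.ofReal (nearConst β))
    (fun n => by rw [lintegral_count]; exact tsum_nearKernel_le hβ hβ' n)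
    (fun ψ _ => by
      rw [lintegral_count, lintegral_muZ, ← ENNReal.tsum_mul_left]
      refine ENNReal.tsum_le_tsum fun j => ?_
      rw [lintegral_muZ, ← mul_assoc]
      exact mul_le_mul_left (tsum_mul_nearKernel_le hβ hβ' j) _)
    count_absolutelyContinuous_muZ hq (φ := φ) (measurable_of_countable _)
  simp_rw [lintegral_count] at hschur
  have h1 := ((memLp_japanese_rpow (by positivity : 0 < α + 2 * β) hq).const_mul c₁).eLpNorm_lt_top
  have h2 : eLpNorm φ q muZ < ∞ := by
    rw [eLpNorm_enorm]; exact hfq.eLpNorm_lt_top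
  have h3 : eLpNorm (fun n => ENNReal.ofReal c₂ * ∑' j, nearKernel β n j * φ j) q muZ ≤
      ENNReal.ofReal c₂ * eLpNorm (fun n => ∑' j, nearKernel β n j * φ j) q muZ :=
    eLpNorm_le_nnreal_smul_eLpNorm_of_ae_le_mul' (c := c₂.toNNReal)
      (Filter.Eventually.of_forall fun n => le_rfl) q
  have hm : ∀ g : ℤ → ℝ≥0∞, AEStronglyMeasurable g muZ := fun g =>
    (measurable_of_countable g).aestronglyMeasurable
  calc _ ≤ eLpNorm ((fun n => ‖c₁ * japanese n ^ (-(α + 2 * β))‖ₑ) +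
        fun n => ENNReal.ofReal c₂ * ∑' j, nearKernel β n j * φ j) q muZ :=
        eLpNorm_mono_enorm fun n => (hle n).trans_eq (enorm_eq_self _).symm
    _ ≤ eLpNorm (fun n => ‖c₁ * japanese n ^ (-(α + 2 * β))‖ₑ) q muZ +
        eLpNorm (fun n => ENNReal.ofReal c₂ * ∑' j, nearKernel β n j * φ j) q muZ :=
        eLpNorm_add_le (hm _) (hm _) hq
    _ < ∞ := by
        refine ENNReal.add_lt_top.2 ⟨?_, h3.trans_lt (ENNReal.mul_lt_top ENNReal.ofReal_lt_top
          (hschur.trans_lt (ENNReal.mul_lt_top ENNReal.ofReal_lt_top h2)))⟩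
        rw [eLpNorm_enorm]; exact h1

end


/-! ### The seminorm: Hardy's inequality in time and the change of derivative order -/

section

instance : SFinite dtOverT := by
  unfold dtOverT; infer_instance

theorem ae_dtOverT_pos : ∀ᵐ t ∂dtOverT, 0 < t :=
  (withDensity_absolutelyContinuous _ _).ae_le (ae_restrict_mem measurableSet_Ioi)

theorem lintegral_dtOverT {g : ℝ → ℝ≥0∞} (hg : Measurable g) :
    ∫⁻ t, g t ∂dtOverT = ∫⁻ t in Ioi 0, ENNReal.ofReal (1 / t) * g t := by
  unfold dtOverT
  rw [lintegral_withDensity_eq_lintegral_mul _ (by fun_prop) hg]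
  rfl

/-- The measure `dt/t` is invariant under dilations. -/
theorem measurePreserving_mul_dtOverT {c : ℝ} (hc : 0 < c) :
    MeasurePreserving (fun t => c * t) dtOverT dtOverT := by
  refine ⟨measurable_const_mul c, ?_⟩
  refine Measure.ext_of_lintegral _ fun g hg => ?_
  have hm : Measurable ((Ioi (0 : ℝ)).indicator fun x => ENNReal.ofReal (c / x) * g x) :=
    (Measurable.mul (by fun_prop) hg).indicator measurableSet_Ioi
  have h1 := lintegral_map (μ := volume) hm (measurable_const_mul c)
  rw [Real.map_volume_mul_left hc.ne', lintegral_smul_measure,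
    lintegral_indicator measurableSet_Ioi, abs_of_pos (inv_pos.2 hc)] at h1
  rw [lintegral_map hg (measurable_const_mul c),
    lintegral_dtOverT (g := fun t => g (c * t)) (hg.comp (measurable_const_mul c)),
    lintegral_dtOverT hg,
    ← lintegral_indicator measurableSet_Ioi]
  refine Eq.trans ?_ (h1.symm.trans ?_)
  · refine lintegral_congr fun t => ?_
    by_cases ht : 0 < t
    · have hct : 0 < c * t := mul_pos hc ht
      rw [indicator_of_mem (mem_Ioi.2 ht), indicator_of_mem (mem_Ioi.2 hct)]
      congr 2
      field_simp
    · have hct : ¬ 0 < c * t := fun h => ht (pos_of_mul_pos_right h hc.le)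
      rw [indicator_of_notMem (by simpa using ht), indicator_of_notMem (by simpa using hct)]
  · rw [smul_eq_mul, ← lintegral_const_mul' _ _ ENNReal.ofReal_ne_top]
    refine setLIntegral_congr_fun measurableSet_Ioi fun x hx => ?_
    have hx : 0 < x := hx
    rw [← mul_assoc, ← ENNReal.ofReal_mul (by positivity)]
    congr 2
    field_simp

/-- The integrand behaves like `ρ^(β-1)` at `0` and `ρ^(β-1-e)` at infinity with respect to `dρ`. -/
theorem lintegral_hardyKernel_lt_top {β e : ℝ} (hβ : 0 < β) (he : β < e) :
    ∫⁻ ρ, ENNReal.ofReal (ρ ^ β * (1 + ρ) ^ (-e)) ∂dtOverT < ∞ := by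
  rw [lintegral_dtOverT (by fun_prop), ← Ioc_union_Ioi_eq_Ioi zero_le_one,
    lintegral_union measurableSet_Ioi (Set.Ioc_disjoint_Ioi le_rfl)]
  have e1 : ∀ ρ : ℝ, 0 < ρ → ENNReal.ofReal (1 / ρ) * ENNReal.ofReal (ρ ^ β * (1 + ρ) ^ (-e)) =
      ENNReal.ofReal (ρ ^ (β - 1) * (1 + ρ) ^ (-e)) := by
    intro ρ hρ
    rw [← ENNReal.ofReal_mul (by positivity), Real.rpow_sub_one hρ.ne']
    congr 1; ring
  refine ENNReal.add_lt_top.2 ⟨?_, ?_⟩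
  · refine lt_of_le_of_lt (setLIntegral_mono' measurableSet_Ioc fun ρ hρ => ?_)
      ((lintegral_Ioc_rpow (by linarith : -1 < β - 1) one_pos).trans_lt ENNReal.ofReal_lt_top)
    have hρ0 : 0 < ρ := hρ.1
    rw [e1 ρ hρ0]
    refine ENNReal.ofReal_le_ofReal (mul_le_of_le_one_right (by positivity) ?_)
    exact Real.rpow_le_one_of_one_le_of_nonpos (by linarith) (by linarith)
  · refine lt_of_le_of_lt (setLIntegral_mono' measurableSet_Ioi fun ρ hρ => ?_)
      ((lintegral_Ioi_rpow (by linarith : β - 1 - e < -1) one_pos).trans_lt ENNReal.ofReal_lt_top)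
    have hρ0 : 0 < ρ := one_pos.trans hρ
    rw [e1 ρ hρ0, sub_eq_add_neg _ e, Real.rpow_add hρ0]
    refine ENNReal.ofReal_le_ofReal (mul_le_mul_of_nonneg_left ?_ (by positivity))
    exact Real.rpow_le_rpow_of_nonpos hρ0 (by linarith) (by linarith)

/-- A Hardy inequality on `(0,∞)` with the measure `dt/t`. -/
theorem eLpNorm_hardy_le {β e : ℝ} {q : ℝ≥0∞} (hq : 1 ≤ q) {ψ : ℝ → ℝ≥0∞} (hψ : Measurable ψ) :
    eLpNorm (fun t => ∫⁻ ρ, ENNReal.ofReal (ρ ^ β * (1 + ρ) ^ (-e)) * ψ ((1 + ρ) * t) ∂dtOverT)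
        q dtOverT ≤
      (∫⁻ ρ, ENNReal.ofReal (ρ ^ β * (1 + ρ) ^ (-e)) ∂dtOverT) * eLpNorm ψ q dtOverT := by
  -- Minkowski over `ρ`; each dilate `ψ((1+ρ)·)` has the norm of `ψ` because `dt/t` is dilation
  -- invariant.
  refine (eLpNorm_lintegral_le (F := fun t ρ =>
    ENNReal.ofReal (ρ ^ β * (1 + ρ) ^ (-e)) * ψ ((1 + ρ) * t)) ?_ hq).trans ?_
  · refine Measurable.mul (by fun_prop) (hψ.comp (by fun_prop))
  · rw [← lintegral_mul_const _ (by fun_prop)]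
    refine lintegral_mono_ae ?_
    filter_upwards [ae_dtOverT_pos] with ρ hρ
    have h1 := eLpNorm_comp_measurePreserving (p := q) hψ.aestronglyMeasurable
      (measurePreserving_mul_dtOverT (by linarith : 0 < 1 + ρ))
    rw [← h1]
    exact eLpNorm_le_nnreal_smul_eLpNorm_of_ae_le_mul'
      (c := (ρ ^ β * (1 + ρ) ^ (-e)).toNNReal) (Filter.Eventually.of_forall fun t => le_rfl) q

/-- Substitute `τ = tρ`; the powers `t^(e-β)`, `t^β` and `t^(-e)` cancel. -/
theorem hardy_substitution {β e t : ℝ} (ht : 0 < t) {ψ : ℝ → ℝ≥0∞} (hψ : Measurable ψ) :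
    ∫⁻ τ in Ioi 0, ENNReal.ofReal (t ^ (e - β) * τ ^ (β - 1) * (t + τ) ^ (-e)) * ψ (t + τ) =
      ∫⁻ ρ, ENNReal.ofReal (ρ ^ β * (1 + ρ) ^ (-e)) * ψ ((1 + ρ) * t) ∂dtOverT := by
  have hm : Measurable fun τ =>
      ENNReal.ofReal (t ^ (e - β) * τ ^ β * (t + τ) ^ (-e)) * ψ (t + τ) :=
    Measurable.mul (by fun_prop) (hψ.comp (by fun_prop))
  have h1 := (measurePreserving_mul_dtOverT ht).lintegral_comp hm
  calc _ = ∫⁻ τ, ENNReal.ofReal (t ^ (e - β) * τ ^ β * (t + τ) ^ (-e)) * ψ (t + τ) ∂dtOverT := by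
        rw [lintegral_dtOverT hm]
        refine setLIntegral_congr_fun measurableSet_Ioi fun τ hτ => ?_
        have hτ : 0 < τ := hτ
        rw [← mul_assoc, ← ENNReal.ofReal_mul (by positivity), Real.rpow_sub_one hτ.ne']
        congr 2; ring
    _ = _ := by
        rw [← h1]
        refine lintegral_congr_ae ?_
        filter_upwards [ae_dtOverT_pos] with ρ hρ
        have e1 : t + t * ρ = (1 + ρ) * t := by ring
        rw [e1]
        congr 2
        rw [Real.mul_rpow ht.le hρ.le, Real.mul_rpow (by linarith) ht.le, Real.rpow_sub ht,
          Real.rpow_neg ht.le]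
        field_simp

variable {f : ℤ → ℝ} {β : ℝ} {p q : ℝ≥0∞}

/-- The function `Δ^k e^{sΔ} f`, extended by zero to `s ≤ 0`. -/
def lapHeat (f : ℤ → ℝ) (k : ℕ) (s : ℝ) (n : ℤ) : ℝ :=
  (Ioi (0 : ℝ)).indicator (fun s => (lap^[k] (heatSemigroup s f)) n) s

theorem lapHeat_of_pos (k : ℕ) {s : ℝ} (hs : 0 < s) :
    lapHeat f k s = lap^[k] (heatSemigroup s f) :=
  funext fun _ => indicator_of_mem (mem_Ioi.2 hs) _

/-- Continuity on `(0,∞)` and extension by zero give Borel measurability on all of `ℝ`, the form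
that Minkowski's inequality asks for. -/
theorem measurable_lapHeat (hh : HeatSummable f) (k : ℕ) (n : ℤ) :
    Measurable fun s => lapHeat f k s n := by
  have hc : ContinuousOn (fun s => (lap^[k] (heatSemigroup s f)) n) (Ioi 0) := fun s hs =>
    (hasDerivAt_iterate_lap (fun n => hasDerivAt_heatSemigroup hh hs n) k
      n).continuousAt.continuousWithinAt
  have := hc.measurable_piecewise (g := (0 : ℝ → ℝ)) continuousOn_const measurableSet_Ioi
  rw [piecewise_eq_indicator] at this
  exact this

theorem measurable_eLpNorm_lapHeat (hh : HeatSummable f) (k : ℕ) (hp : 1 ≤ p) :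
    Measurable fun s => eLpNorm (lapHeat f k s) p Measure.count := by
  have hF : Measurable (Function.uncurry fun (n : ℤ) (s : ℝ) => ‖lapHeat f k s n‖ₑ) :=
    measurable_from_prod_countable_right fun n => (measurable_lapHeat hh k n).enorm
  have := measurable_eLpNorm_section (μ := (Measure.count : Measure ℤ)) hF hp
  simpa only [eLpNorm_enorm] using this

/-- Write `Δ^(k+1) e^{sΔ} = Δ e^{(s/2)Δ} (Δ^k e^{(s/2)Δ})` and smooth for time `s/2`: `128/(s/2) =
256/s`. -/
theorem eLpNorm_lapHeat_succ_le (hh : HeatSummable f) (k : ℕ) (hp : 1 ≤ p) {s : ℝ} (hs : 0 < s) :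
    eLpNorm (lapHeat f (k + 1) s) p Measure.count ≤
      ENNReal.ofReal (256 / s) * eLpNorm (lapHeat f k (s / 2)) p Measure.count := by
  have hs2 : 0 < s / 2 := by positivity
  rw [lapHeat_of_pos _ hs, lapHeat_of_pos _ hs2]
  have e : lap^[k + 1] (heatSemigroup s f) =
      lap (heatSemigroup (s / 2) (lap^[k] (heatSemigroup (s / 2) f))) := by
    have e1 : heatSemigroup s f = heatSemigroup (s / 2) (heatSemigroup (s / 2) f) := by
      ext m; rw [heatSemigroup_add hh hs2 hs2, add_halves]
    rw [Function.iterate_succ_apply', heatSemigroup_iterate_lap (hh.heatSemigroup hs2) hs2, ← e1]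
  rw [e]
  refine (eLpNorm_lap_heatSemigroup_le ((hh.heatSemigroup hs2).iterate_lap k) hs2 hp).trans
    (le_of_eq ?_)
  congr 2
  field_simp
  norm_num

theorem eLpNorm_const_mul_count (c : ℝ) (w : ℤ → ℝ) (p : ℝ≥0∞) :
    eLpNorm (fun n => c * w n) p Measure.count = ‖c‖ₑ * eLpNorm w p Measure.count :=
  eLpNorm_const_smul c w p Measure.count

/-- Minkowski's inequality for `∂_t^k e^{tΔ} (-Δ)^(-β) f`. -/
theorem eLpNorm_iteratedDeriv_negFracPower_le (hβ : 0 < β) (hβ' : β < 1 / 2)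
    (hf : f ∈ ellSpace (-β)) (hp : 1 ≤ p) (k : ℕ) {t : ℝ} (ht : 0 < t) :
    eLpNorm (fun n => iteratedDeriv k (fun s => heatSemigroup s (negFracPower β f) n) t) p
        Measure.count ≤
      ‖1 / Real.Gamma β‖ₑ * ∫⁻ τ in Ioi 0, ENNReal.ofReal (τ ^ (β - 1)) *
        eLpNorm (lapHeat f k (t + τ)) p Measure.count := by
  have hh := heatSummable_of_mem_ellSpace hβ hβ' hf
  simp_rw [iteratedDeriv_heatSemigroup_negFracPower hβ hβ' hf k ht]
  rw [eLpNorm_const_mul_count]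
  gcongr
  set F : ℤ → ℝ → ℝ≥0∞ := fun n τ => ‖lapHeat f k (t + τ) n * τ ^ (β - 1)‖ₑ
  have hF : Measurable (Function.uncurry F) :=
    measurable_from_prod_countable_right fun n =>
      (((measurable_lapHeat hh k n).comp (measurable_const_add t)).mul
        (measurable_id.pow_const _)).enorm
  have h1 : ∀ n, ‖∫ τ in Ioi (0 : ℝ), (lap^[k] (heatSemigroup (t + τ) f)) n * τ ^ (β - 1)‖ₑ ≤
      ‖∫⁻ τ in Ioi 0, F n τ‖ₑ := by
    intro n
    rw [enorm_eq_self]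
    refine (enorm_integral_le_lintegral_enorm _).trans
      (setLIntegral_mono' measurableSet_Ioi fun τ hτ => ?_)
    have hτ : 0 < τ := hτ
    simp only [F]
    rw [lapHeat_of_pos _ (by linarith)]
  refine (eLpNorm_mono_enorm h1).trans ((eLpNorm_lintegral_le hF hp).trans ?_)
  refine setLIntegral_mono' measurableSet_Ioi fun τ hτ => ?_
  have hτ : 0 < τ := hτ
  simp only [F]
  rw [eLpNorm_enorm]
  simp_rw [mul_comm _ (τ ^ (β - 1))]
  rw [eLpNorm_const_mul_count, Real.enorm_of_nonneg (by positivity)]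

/-- Decay `s^(-e)` of `Δ^k e^{sΔ}f`, up to a profile in `L^q(dt/t)`, becomes decay `t^(-(e-β))`:
Minkowski in `τ` leaves a Hardy operator acting on `ψ`. Keeping `k` and `e` independent lets one
statement serve both possible derivative orders. -/
theorem mixedNorm_negFracPower_lt_top (hβ : 0 < β) (hβ' : β < 1 / 2) (hf : f ∈ ellSpace (-β))
    (hp : 1 ≤ p) (hq : 1 ≤ q) {k : ℕ} {e : ℝ} (he : β < e) {ψ : ℝ → ℝ≥0∞} (hψ : Measurable ψ)
    (hψq : eLpNorm ψ q dtOverT < ∞)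
    (hle : ∀ s, 0 < s → eLpNorm (lapHeat f k s) p Measure.count ≤ ENNReal.ofReal (s ^ (-e)) * ψ s) :
    mixedNorm p q (fun t n => t ^ (e - β) *
      iteratedDeriv k (fun s => heatSemigroup s (negFracPower β f) n) t) < ∞ := by
  have h1 : ∀ᵐ t ∂dtOverT, ‖eLpNorm (fun n => t ^ (e - β) *
      iteratedDeriv k (fun s => heatSemigroup s (negFracPower β f) n) t) p Measure.count‖ₑ ≤
      ((1 / Real.Gamma β).toNNReal : ℝ≥0∞) *
      ‖∫⁻ ρ, ENNReal.ofReal (ρ ^ β * (1 + ρ) ^ (-e)) * ψ ((1 + ρ) * t) ∂dtOverT‖ₑ := by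
    filter_upwards [ae_dtOverT_pos] with t ht
    have hΓ : 0 < Real.Gamma β := Real.Gamma_pos_of_pos hβ
    have hte : 0 ≤ t ^ (e - β) := by positivity
    rw [enorm_eq_self, enorm_eq_self, eLpNorm_const_mul_count, ← hardy_substitution ht hψ]
    refine (mul_le_mul_right (eLpNorm_iteratedDeriv_negFracPower_le hβ hβ' hf hp k ht) _).trans ?_
    rw [mul_left_comm, Real.enorm_of_nonneg (by positivity : 0 ≤ 1 / Real.Gamma β),
      Real.enorm_of_nonneg hte, ← lintegral_const_mul' _ _ ENNReal.ofReal_ne_top]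
    refine mul_le_mul_right (setLIntegral_mono' measurableSet_Ioi fun τ hτ => ?_) _
    have hτ : 0 < τ := hτ
    refine (mul_le_mul_right (mul_le_mul_right (hle (t + τ) (by linarith)) _) _).trans (le_of_eq ?_)
    rw [ENNReal.ofReal_mul (by positivity), ENNReal.ofReal_mul hte]
    ring
  unfold mixedNorm
  refine (eLpNorm_le_nnreal_smul_eLpNorm_of_ae_le_mul' h1 q).trans_lt ?_
  refine ENNReal.mul_lt_top ENNReal.coe_lt_top ((eLpNorm_hardy_le hq hψ).trans_lt ?_)
  exact ENNReal.mul_lt_top (lintegral_hardyKernel_lt_top hβ he) hψq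

theorem negFracPower_mem_heatBesov {α : ℝ} (hα : 0 < α) (hβ : 0 < β) (hβ' : β < 1 / 2)
    (hp : 1 ≤ p) (hq : 1 ≤ q) (hf : f ∈ heatBesov α p q) (hfβ : f ∈ ellSpace (-β)) :
    negFracPower β f ∈ heatBesov (α + 2 * β) p q := by
  have hh := heatSummable_of_mem_ellSpace hβ hβ' hfβ
  refine ⟨memLp_negFracPower hα hβ hβ' hfβ hq hf.1, ?_⟩
  have hfin := hf.2
  set k := ⌊α / 2⌋₊ + 1
  set l := ⌊(α + 2 * β) / 2⌋₊ + 1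
  set φ : ℝ → ℝ≥0∞ := fun s => ENNReal.ofReal (s ^ ((k : ℝ) - α / 2)) *
    eLpNorm (lapHeat f k s) p Measure.count
  have hφ : Measurable φ :=
    Measurable.mul (by fun_prop) (measurable_eLpNorm_lapHeat hh k hp)
  have hφq : eLpNorm φ q dtOverT < ∞ := by
    refine lt_of_le_of_lt (eLpNorm_mono_enorm_ae ?_) hfin
    filter_upwards [ae_dtOverT_pos] with s hs
    rw [enorm_eq_self, enorm_eq_self, eLpNorm_const_mul_count, Real.enorm_of_nonneg (by positivity)]
    simp_rw [iteratedDeriv_heatSemigroup hh k hs]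
    simp only [φ]
    rw [lapHeat_of_pos _ hs]
  have hφle : ∀ s, 0 < s → eLpNorm (lapHeat f k s) p Measure.count =
      ENNReal.ofReal (s ^ (-((k : ℝ) - α / 2))) * φ s := by
    intro s hs
    simp only [φ]
    rw [← mul_assoc, ← ENNReal.ofReal_mul (by positivity), ← Real.rpow_add hs, neg_add_cancel,
      Real.rpow_zero, ENNReal.ofReal_one, one_mul]
  clear_value φ
  have hl : (α + 2 * β) / 2 < (l : ℝ) := by
    simp only [l]; push_cast; exact Nat.lt_floor_add_one _
  -- Adding `β < 1` to `α/2` raises the integer part by at most one.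
  have hkl : l = k ∨ l = k + 1 := by
    have h1 : ⌊α / 2⌋₊ ≤ ⌊(α + 2 * β) / 2⌋₊ := Nat.floor_le_floor (by linarith)
    have h2 : ⌊(α + 2 * β) / 2⌋₊ ≤ ⌊α / 2⌋₊ + 1 := by
      rw [← Nat.floor_add_one (by positivity)]
      exact Nat.floor_le_floor (by linarith)
    omega
  have key : ∃ ψ : ℝ → ℝ≥0∞, Measurable ψ ∧ eLpNorm ψ q dtOverT < ∞ ∧
      ∀ s, 0 < s → eLpNorm (lapHeat f l s) p Measure.count ≤
        ENNReal.ofReal (s ^ (-((l : ℝ) - α / 2))) * ψ s := by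
    rcases hkl with h | h
    · rw [h]
      exact ⟨φ, hφ, hφq, fun s hs => (hφle s hs).le⟩
    · rw [h]
      set a := (k : ℝ) - α / 2
      -- The factor `256` comes from smoothing for half the time, and `2^a` from `(s/2)^(-a) = 2^a
      -- s^(-a)`.
      set c : ℝ := 256 * 2 ^ a
      have h2 := eLpNorm_comp_measurePreserving (p := q) hφ.aestronglyMeasurable
        (measurePreserving_mul_dtOverT (by norm_num : (0 : ℝ) < 1 / 2))
      refine ⟨fun s => ENNReal.ofReal c * φ (1 / 2 * s),
        (hφ.comp (measurable_const_mul _)).const_mul _, ?_, fun s hs => ?_⟩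
      · refine (eLpNorm_le_nnreal_smul_eLpNorm_of_ae_le_mul' (c := c.toNNReal)
          (g := φ ∘ fun s => 1 / 2 * s) (Filter.Eventually.of_forall fun s => le_rfl) q).trans_lt ?_
        rw [h2]
        exact ENNReal.mul_lt_top ENNReal.coe_lt_top hφq
      · refine (eLpNorm_lapHeat_succ_le hh k hp hs).trans (le_of_eq ?_)
        change _ = ENNReal.ofReal (s ^ (-(((k + 1 : ℕ) : ℝ) - α / 2))) *
          (ENNReal.ofReal c * φ (1 / 2 * s))
        rw [hφle _ (by positivity : 0 < s / 2), ← mul_assoc, ← mul_assoc,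
          ← ENNReal.ofReal_mul (by positivity), ← ENNReal.ofReal_mul (by positivity),
          show s / 2 = 1 / 2 * s by ring]
        refine congrArg (fun x => ENNReal.ofReal x * φ (1 / 2 * s)) ?_
        have e1 : -(((k + 1 : ℕ) : ℝ) - α / 2) = -1 + -a := by
          simp only [a]; push_cast; ring
        rw [e1, Real.rpow_add hs, Real.rpow_neg_one, Real.mul_rpow (by norm_num) hs.le,
          one_div, Real.inv_rpow zero_le_two, Real.rpow_neg zero_le_two, inv_inv]
        simp only [c]
        ring
  obtain ⟨ψ, hψ, hψq, hle⟩ := key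
  -- Here `e = l - α/2`, and `β < e` is the inequality `(α+2β)/2 < l`, which holds since `l` is one
  -- more than the integer part.
  have := mixedNorm_negFracPower_lt_top hβ hβ' hfβ hp hq
    (by linarith : β < (l : ℝ) - α / 2) hψ hψq hle
  rw [show (l : ℝ) - α / 2 - β = (l : ℝ) - (α + 2 * β) / 2 by ring] at this
  exact this

end

end DiscreteBesov

end

theorem theorem1p3 (α β : ℝ) (p q : ℝ≥0∞) (hα : 0 < α) (hβ : 0 < β) (hβ' : β < 1 / 2)
    (hp : 1 ≤ p) (hq : 1 ≤ q) (f : ℤ → ℝ)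
    (hf : f ∈ DiscreteBesov.heatBesov α p q ∩ DiscreteBesov.ellSpace (-β)) :
    DiscreteBesov.NegFracPowerDefined β f ∧
      DiscreteBesov.negFracPower β f ∈ DiscreteBesov.heatBesov (α + 2 * β) p q :=
  ⟨DiscreteBesov.negFracPowerDefined_of_mem_ellSpace hβ hβ' hf.2,
    DiscreteBesov.negFracPower_mem_heatBesov hα hβ hβ' hp hq hf.1 hf.2⟩
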